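/- Let $k$ be a field with $\mathrm{char}(k)\neq 2$. Let $D_\infty=\mathbb Z_2*\mathbb Z_2=\langle g_0,g_1\mid g_0^2=1=g_1^2\rangle$, with the action of $\mathbb Z_2=\langle h\rangle$ by automorphisms given by $h.g_0=g_1$, $h.g_1=g_0$. For a finite group $H$ acting by automorphisms on a group $\Gamma$, the smash coproduct $k[\Gamma]\rtimes k^H$ is the Hopf algebra equal to $k[\Gamma]\otimes k^H$ as an algebra, with (writing $r\#\delta_h=r\otimes\delta_h$, $r\in\Gamma$, $h\in H$) $$\Delta(r\#\delta_h)=\sum_{l\in H}r\#\delta_{l^{-1}}\otimes l.r\#\delta_{lh},\quad \varepsilon(r\#\delta_h)=\delta_{h,1},\quad S(r\#\delta_h)=h^{-1}.r^{-1}\#\delta_{h^{-1}}.$$ If $N\subset\Gamma$ is a normal $H$-stable subgroup and $\Phi:N\to(k^H)^\times$ is a group morphism with $\Phi(r)(lh)=\Phi(l^{-1}.r)(h)\Phi(r)(l)$ and $\Phi(srs^{-1})=\Phi(r)$ for all $r\in N$, $s\in\Gamma$, $h,l\in H$, then $k[\Gamma/N]\rtimes_\Phi k^H$ is the vector space $k[\Gamma/N]\otimes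 k^H$ with unit $1\#1$, counit $\varepsilon(x\#\delta_h)=\delta_{h,1}$ and, for $x,y\in\Gamma/N$ and $h,g\in H$, $$(x\#\delta_h)(y\#\delta_g)=xy\#\delta_h\delta_g\,\Phi(j(x)j(y)j(xy)^{-1}),$$ $$\Delta(x\#\delta_h)=\sum_{l\in H}x\#\delta_{l^{-1}}\otimes l.x\#\delta_{lh}\,\Phi\big((l.j(x))\,j(l.x)^{-1}\big),$$ $$S(x\#\delta_h)=h^{-1}.x^{-1}\#\Phi\big(j(h^{-1}.x^{-1})^{-1}\,(h^{-1}.j(x)^{-1})\big)\delta_{h^{-1}},$$ where $j:\Gamma/N\to\Gamma$ is a section of the projection with $j(1)=1$ (these formulas define a Hopf algebra, which up to isomorphism does not depend on $j$). For $m\ge 1$ let $D_m$ be the dihedral group of order $2m$, let $N_m=\langle (g_0g_1)^m\rangle\subset D_\infty$ (a normal, $\mathbb Z_2$-stable, infinite cyclic subgroup), and let $\Phi_m:N_m\to(k^{\mathbb Z_2})^\times$ be the group morphism sending $(g_0g_1)^m$ to the non-trivial character $\chi:\mathbb Z_2\to\{\pm1\}$. Put $$A(m)=k[D_\infty/N_m]\rtimes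 k^{\mathbb Z_2},\qquad B(m)=k[D_\infty/N_m]\rtimes_{\Phi_m}k^{\mathbb Z_2}.$$ A non-trivial Hopf algebra quotient of a Hopf algebra $A$ is a Hopf algebra $L$ with $\dim L>1$ for which there is a surjective, non-injective Hopf algebra map $A\to L$. **Proposition.** Up to isomorphism, the non-trivial Hopf algebra quotients of $k[D_\infty]\rtimes k^{\mathbb Z_2}$ are exactly the following Hopf algebras: 1. the group algebras $k[D_m]$, $m\geq 1$, and $k[D_\infty]$; 2. $A(m)$, $m\ge1$; 3. $B(m)$, $m\ge1$. Moreover $A(m)\simeq k[D_m]\rtimes k^{\mathbb Z_2}$ for every $m\ge 1$, where $\mathbb Z_2$ acts on $D_m$ by exchanging the two generating reflections (the images of $g_0$ and $g_1$). Consequently, up to isomorphism, the only non-trivial infinite-dimensional Hopf algebra quotient of $k[D_\infty]\rtimes k^{\mathbb Z_2}$ is $k[D_\infty]=k[\mathbb Z_2*\mathbb Z_2]$. -/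

import Mathlib

open scoped TensorProduct

noncomputable section

/-! ## Crossed coproducts

A group `H` (later: finite) acts by automorphisms on a group `Q`.  We build Hopf algebra structures
on the vector space `k[Q] ⊗ k^H`, with basis `x # δ_h` (`x ∈ Q`, `h ∈ H`), of the following form:

* `(x # δ_h) (y # δ_g) = x y # δ_h δ_g σ(x, y)`, with unit `1 # 1 = ∑ h, 1 # δ_h`;
* `Δ (x # δ_h) = ∑ l, (x # δ_{l⁻¹}) ⊗ (l • x # δ_{l h} τ(l, x))`, `ε (x # δ_h) = δ_{h, 1}`;
* `S (x # δ_h) = (h⁻¹ • x⁻¹) # s(x, h) δ_{h⁻¹}`.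

Here `σ(x, y), τ(l, x), s(x, h)` are functions on `H`, and a function `f` times `δ_h` is
`f(h) δ_h`; thus only the values `τ(l, x)(l h)` and the scalar `s(x, h) = s(x, h)(h⁻¹)` matter.
The smash coproduct `k[Q] ⋊ k^H` is the case `σ = τ = s = 1`, and the twisted version
`k[Γ/N] ⋊_Φ k^H` is obtained below from a quotient datum; in both cases the laws are proved. -/

/-- The coefficients in the formulas above, with the identities that make them define a
Hopf algebra. -/
structure CocycleDatum (k Q H : Type*) [Field k] [Group Q] [Group H]
    [MulDistribMulAction H Q] where
  σ : Q → Q → H → k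
  τ : H → Q → H → k
  s : Q → H → k
  σ_one_left : ∀ x h, σ 1 x h = 1
  σ_one_right : ∀ x h, σ x 1 h = 1
  σ_assoc : ∀ x y z h, σ x y h * σ (x * y) z h = σ y z h * σ x (y * z) h
  σ_counit : ∀ x y, σ x y 1 = 1
  τ_one_elt : ∀ l h, τ l 1 h = 1
  τ_one_left : ∀ x h, τ 1 x h = 1
  τ_counit : ∀ l x, τ l x 1 = 1
  τ_coassoc : ∀ q m x g,
    τ (q * m) x (q * g) * τ m x q⁻¹ = τ m x g * τ q (m • x) (q * g)
  τ_mul : ∀ l x y h, σ x y h * τ l (x * y) (l * h) =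
    τ l x (l * h) * τ l y (l * h) * σ x y l⁻¹ * σ (l • x) (l • y) (l * h)
  s_left : ∀ l x, τ l x l * s x l⁻¹ * σ (l • x⁻¹) (l • x) l = 1
  s_right : ∀ l x, τ l x l * s (l • x) l * σ x x⁻¹ l⁻¹ = 1

/-- The vector space `k[Q] ⊗ k^H`, as the free vector space on the set of symbols `x # δ_h`. -/
def Crossed {k Q H : Type*} [Field k] [Group Q] [Group H] [MulDistribMulAction H Q]
    (_D : CocycleDatum k Q H) : Type _ :=
  (Q × H) →₀ k

namespace Crossed

variable {k Q H : Type*} [Field k] [Group Q] [Group H] [MulDistribMulAction H Q]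
variable {D : CocycleDatum k Q H}

instance : AddCommGroup (Crossed D) := inferInstanceAs (AddCommGroup ((Q × H) →₀ k))

instance : Module k (Crossed D) := inferInstanceAs (Module k ((Q × H) →₀ k))

/-- The basis vector `x # δ_h`. -/
def of (D : CocycleDatum k Q H) (x : Q) (h : H) : Crossed D :=
  (Finsupp.single (x, h) 1 : (Q × H) →₀ k)

/-- The linear map with prescribed values on the basis. -/
def lin {V : Type*} [AddCommGroup V] [Module k V] (D : CocycleDatum k Q H) (f : Q → H → V) :
    Crossed D →ₗ[k] V :=
  Finsupp.linearCombination k (fun p : Q × H => f p.1 p.2)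

@[simp] theorem lin_of {V : Type*} [AddCommGroup V] [Module k V] (f : Q → H → V) (x : Q) (h : H) :
    lin D f (of D x h) = f x h := by
  unfold lin of
  exact (Finsupp.linearCombination_single k 1 (x, h)).trans (one_smul _ _)

theorem hom_ext {V : Type*} [AddCommGroup V] [Module k V] {f g : Crossed D →ₗ[k] V}
    (hfg : ∀ x h, f (of D x h) = g (of D x h)) : f = g := by
  refine Finsupp.lhom_ext' (M := k) (R := k) (α := Q × H) (φ := f) (ψ := g) fun p => ?_
  refine LinearMap.ext_ring ?_
  exact hfg p.1 p.2

theorem hom_ext₂ {V : Type*} [AddCommGroup V] [Module k V]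
    {f g : Crossed D →ₗ[k] Crossed D →ₗ[k] V}
    (hfg : ∀ x h y i, f (of D x h) (of D y i) = g (of D x h) (of D y i)) : f = g :=
  hom_ext fun x h => hom_ext fun y i => hfg x h y i


instance [Fintype H] : One (Crossed D) := ⟨∑ h : H, of D 1 h⟩

theorem one_def [Fintype H] : (1 : Crossed D) = ∑ h : H, of D 1 h := rfl

variable [DecidableEq H]

/-- The multiplication, as a bilinear map. -/
def mulLin (D : CocycleDatum k Q H) : Crossed D →ₗ[k] Crossed D →ₗ[k] Crossed D :=
  lin D fun x h => lin D fun y g => if h = g then D.σ x y h • of D (x * y) h else 0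

instance : Mul (Crossed D) := ⟨fun a b => mulLin D a b⟩

theorem mul_def (a b : Crossed D) : a * b = mulLin D a b := rfl

/-- The product formula on the basis. -/
theorem of_mul_of (x y : Q) (h g : H) :
    of D x h * of D y g = if h = g then D.σ x y h • of D (x * y) h else 0 := by
  simp [mul_def, mulLin]

theorem mul_assoc_aux (a b c : Crossed D) : a * b * c = a * (b * c) := by
  have h3 : ∀ x h y i, mulLin D (mulLin D (of D x h) (of D y i)) =
      (mulLin D (of D x h)).comp (mulLin D (of D y i)) := by
    intro x h y i
    refine hom_ext fun z j => ?_
    simp only [LinearMap.comp_apply, ← mul_def, of_mul_of]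
    by_cases hh : h = i
    · subst hh
      by_cases hj : h = j
      · subst hj
        simp only [if_true, mul_def, map_smul, LinearMap.smul_apply]
        simp only [← mul_def, of_mul_of, if_true, smul_smul, D.σ_assoc, mul_assoc]
      · simp only [if_true, hj, if_false, mul_def, map_smul, LinearMap.smul_apply, map_zero]
        simp only [← mul_def, of_mul_of, hj, if_false, smul_zero]
    · by_cases hj : i = j
      · subst hj
        simp only [if_true, hh, if_false, mul_def, map_smul, map_zero, LinearMap.zero_apply]
        simp only [← mul_def, of_mul_of, hh, if_false, smul_zero]
      · simp [hh, hj, mul_def]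
  have h2 : ∀ x h, (mulLin D).comp (mulLin D (of D x h)) =
      (LinearMap.llcomp k _ _ _ (mulLin D (of D x h))).comp (mulLin D) :=
    fun x h => hom_ext fun y i => h3 x h y i
  have h0 : ((mulLin D).flip c).comp ((mulLin D).flip b) = (mulLin D).flip (mulLin D b c) :=
    hom_ext fun x h => LinearMap.congr_fun (LinearMap.congr_fun (h2 x h) b) c
  exact LinearMap.congr_fun h0 a

variable [Fintype H]

theorem mulLin_one_left : mulLin D 1 = LinearMap.id := by
  refine hom_ext fun x h => ?_
  simp [one_def, mulLin, D.σ_one_left]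

theorem mulLin_one_right : (mulLin D).flip 1 = LinearMap.id := by
  refine hom_ext fun x h => ?_
  simp [one_def, mulLin, D.σ_one_right]

instance : Ring (Crossed D) where
  __ := (inferInstance : AddCommGroup (Crossed D))
  mul := (· * ·)
  one := 1
  left_distrib a b c := by simp [mul_def]
  right_distrib a b c := by simp [mul_def]
  zero_mul a := by simp [mul_def]
  mul_zero a := by simp [mul_def]
  mul_assoc := mul_assoc_aux
  one_mul a := LinearMap.congr_fun mulLin_one_left a
  mul_one a := LinearMap.congr_fun mulLin_one_right a

instance : Algebra k (Crossed D) :=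
  Algebra.ofModule (fun r a b => by simp [mul_def]) (fun r a b => by simp [mul_def])

/-- The comultiplication. -/
def comulLin (D : CocycleDatum k Q H) : Crossed D →ₗ[k] Crossed D ⊗[k] Crossed D :=
  lin D fun x h => ∑ l : H, of D x l⁻¹ ⊗ₜ[k] (D.τ l x (l * h) • of D (l • x) (l * h))

/-- The counit. -/
def counitLin (D : CocycleDatum k Q H) : Crossed D →ₗ[k] k :=
  lin D fun _ h => if h = 1 then 1 else 0

/-- The antipode. -/
def antipodeLin (D : CocycleDatum k Q H) : Crossed D →ₗ[k] Crossed D :=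
  lin D fun x h => D.s x h • of D (h⁻¹ • x⁻¹) h⁻¹

instance : CoalgebraStruct k (Crossed D) where
  comul := comulLin D
  counit := counitLin D

/-- The coproduct formula on the basis. -/
theorem comul_of (x : Q) (h : H) : CoalgebraStruct.comul (R := k) (of D x h) =
    ∑ l : H, of D x l⁻¹ ⊗ₜ[k] (D.τ l x (l * h) • of D (l • x) (l * h)) :=
  lin_of _ _ _

/-- The counit formula on the basis. -/
theorem counit_of (x : Q) (h : H) :
    CoalgebraStruct.counit (R := k) (of D x h) = if h = 1 then 1 else 0 :=
  lin_of _ _ _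

instance : Coalgebra k (Crossed D) where
  coassoc := by
    refine hom_ext fun x h => ?_
    simp only [LinearMap.comp_apply, comul_of, map_sum, LinearMap.rTensor_tmul,
      LinearMap.lTensor_tmul, TensorProduct.sum_tmul, TensorProduct.tmul_sum, map_smul,
      TensorProduct.tmul_smul, LinearEquiv.coe_coe, TensorProduct.assoc_tmul, Finset.smul_sum,
      ← TensorProduct.smul_tmul', smul_smul]
    rw [Finset.sum_comm]
    refine Finset.sum_congr rfl fun m _ => ?_
    refine Fintype.sum_equiv (Equiv.mulRight m⁻¹) _ _ fun l => ?_
    have key := D.τ_coassoc (l * m⁻¹) m x (m * h)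
    simp only [Equiv.coe_mulRight]
    simp only [mul_inv_rev, inv_inv, mul_assoc, inv_mul_cancel_left, inv_mul_cancel,
      mul_one] at key ⊢
    rw [key]
  rTensor_counit_comp_comul := by
    refine hom_ext fun x h => ?_
    simp only [LinearMap.comp_apply, comul_of, map_sum, LinearMap.rTensor_tmul, counit_of,
      TensorProduct.mk_apply]
    rw [Finset.sum_eq_single 1]
    · simp [D.τ_one_left]
    · intro l _ hl
      simp [hl]
    · simp
  lTensor_counit_comp_comul := by
    refine hom_ext fun x h => ?_
    simp only [LinearMap.comp_apply, comul_of, map_sum, LinearMap.lTensor_tmul, counit_of,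
      TensorProduct.mk_apply, map_smul, LinearMap.flip_apply]
    rw [Finset.sum_eq_single h⁻¹]
    · simp [D.τ_counit]
    · intro l _ hl
      have : l * h ≠ 1 := fun e => hl (eq_inv_of_mul_eq_one_left e)
      simp [this]
    · simp

instance : Bialgebra k (Crossed D) where
  counit_one := by
    simp [one_def, counit_of]
  mul_compr₂_counit := by
    refine hom_ext₂ fun x h y i => ?_
    simp only [LinearMap.compr₂_apply, LinearMap.mul_apply', LinearMap.compl₁₂_apply, of_mul_of,
      counit_of]
    by_cases hh : h = i
    · subst hh
      by_cases h1 : h = 1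
      · subst h1
        simp [counit_of, D.σ_counit]
      · simp [counit_of, h1]
    · by_cases h1 : h = 1
      · have : i ≠ 1 := fun e => hh (h1.trans e.symm)
        simp [hh, this]
      · simp [hh, h1]
  comul_one := by
    simp only [one_def, map_sum, comul_of, smul_one, D.τ_one_elt, one_smul,
      Algebra.TensorProduct.one_def, TensorProduct.sum_tmul, TensorProduct.tmul_sum]
    rw [Finset.sum_comm]
    conv_rhs => rw [Finset.sum_comm]
    refine Fintype.sum_equiv (Equiv.inv H) _ _ fun l => ?_
    exact Fintype.sum_equiv (Equiv.mulLeft l) _ _ fun h => rfl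
  mul_compr₂_comul := by
    refine hom_ext₂ fun x h y i => ?_
    simp only [LinearMap.compr₂_apply, LinearMap.mul_apply', LinearMap.compl₁₂_apply, of_mul_of,
      comul_of, Finset.sum_mul_sum, Algebra.TensorProduct.tmul_mul_tmul, inv_inj,
      smul_mul_assoc, mul_smul_comm]
    by_cases hh : h = i
    · subst hh
      simp only [if_true, map_smul, comul_of, Finset.smul_sum]
      refine Finset.sum_congr rfl fun l _ => ?_
      rw [Finset.sum_eq_single l]
      · simp only [if_true, TensorProduct.tmul_smul, ← TensorProduct.smul_tmul', smul_smul,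
          smul_mul']
        congr 1
        rw [D.τ_mul]
        ring
      · intro m _ hm
        simp [Ne.symm hm]
      · simp
    · simp only [hh, if_false, map_zero]
      symm
      refine Finset.sum_eq_zero fun l _ => Finset.sum_eq_zero fun m _ => ?_
      by_cases hm : l = m
      · subst hm
        simp [hh]
      · simp [hm]

instance : HopfAlgebraStruct k (Crossed D) where
  antipode := antipodeLin D

/-- The antipode formula on the basis. -/
theorem antipode_of (x : Q) (h : H) :
    HopfAlgebraStruct.antipode k (of D x h) = D.s x h • of D (h⁻¹ • x⁻¹) h⁻¹ := by
  change antipodeLin D (of D x h) = _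
  unfold antipodeLin
  rw [lin_of]

instance : HopfAlgebra k (Crossed D) where
  mul_antipode_rTensor_comul := by
    refine hom_ext fun x h => ?_
    simp only [LinearMap.comp_apply, comul_of, map_sum, LinearMap.rTensor_tmul, antipode_of,
      LinearMap.mul'_apply, smul_mul_assoc, mul_smul_comm, of_mul_of, inv_inv, counit_of,
      Algebra.linearMap_apply, Algebra.algebraMap_eq_smul_one, one_def, Finset.smul_sum]
    refine Finset.sum_congr rfl fun l _ => ?_
    by_cases h1 : h = 1
    · subst h1
      have key := D.s_left l x
      rw [mul_assoc] at key
      simp only [mul_one, if_true, smul_smul, one_smul, ← smul_mul', inv_mul_cancel, smul_one]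
      rw [key, one_smul]
    · simp [h1]
  mul_antipode_lTensor_comul := by
    refine hom_ext fun x h => ?_
    simp only [LinearMap.comp_apply, comul_of, map_sum, LinearMap.lTensor_tmul, antipode_of,
      LinearMap.mul'_apply, mul_smul_comm, of_mul_of, map_smul, counit_of,
      Algebra.linearMap_apply, Algebra.algebraMap_eq_smul_one, one_def, Finset.smul_sum]
    refine Fintype.sum_equiv (Equiv.inv H) _ _ fun l => ?_
    by_cases h1 : h = 1
    · subst h1
      have key := D.s_right l x
      rw [mul_assoc] at key
      simp only [mul_one, if_true, smul_smul, one_smul, Equiv.inv_apply]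
      rw [← smul_inv', inv_smul_smul, key, one_smul, mul_inv_cancel]
    · simp [h1]

end Crossed

/-! ## The smash coproduct -/

/-- The data `σ = τ = s = 1`. -/
def CocycleDatum.trivial (k Γ H : Type*) [Field k] [Group Γ] [Group H]
    [MulDistribMulAction H Γ] : CocycleDatum k Γ H where
  σ _ _ _ := 1
  τ _ _ _ := 1
  s _ _ := 1
  σ_one_left _ _ := rfl
  σ_one_right _ _ := rfl
  σ_assoc _ _ _ _ := rfl
  σ_counit _ _ := rfl
  τ_one_elt _ _ := rfl
  τ_one_left _ _ := rfl
  τ_counit _ _ := rfl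
  τ_coassoc _ _ _ _ := rfl
  τ_mul _ _ _ _ := by simp
  s_left _ _ := by simp
  s_right _ _ := by simp

section

variable {k Γ H : Type*} [Field k] [Group Γ] [Group H] [MulDistribMulAction H Γ]

@[simp] theorem CocycleDatum.trivial_σ (x y : Γ) (h : H) : (trivial k Γ H).σ x y h = 1 := rfl
@[simp] theorem CocycleDatum.trivial_τ (l : H) (x : Γ) (h : H) : (trivial k Γ H).τ l x h = 1 := rfl
@[simp] theorem CocycleDatum.trivial_s (x : Γ) (h : H) : (trivial k Γ H).s x h = 1 := rfl

end

/-- The smash coproduct Hopf algebra `k[Γ] ⋊ k^H` of a finite group `H` acting by automorphisms on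
a group `Γ`. -/
abbrev SmashCoproduct (k Γ H : Type*) [Field k] [Group Γ] [Group H]
    [MulDistribMulAction H Γ] : Type _ :=
  Crossed (CocycleDatum.trivial k Γ H)

namespace SmashCoproduct

variable {k Γ H : Type*} [Field k] [Group Γ] [Group H] [MulDistribMulAction H Γ]

/-- The basis element `r # δ_h` of `k[Γ] ⋊ k^H`. -/
abbrev of (k : Type*) {Γ H : Type*} [Field k] [Group Γ] [Group H] [MulDistribMulAction H Γ]
    (r : Γ) (h : H) : SmashCoproduct k Γ H :=
  Crossed.of (CocycleDatum.trivial k Γ H) r h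

variable [DecidableEq H]

/-- `(r # δ_h) (s # δ_g) = r s # δ_h δ_g`. -/
theorem of_mul_of (r s : Γ) (h g : H) :
    of k r h * of k s g = if h = g then of k (r * s) h else 0 := by
  rw [Crossed.of_mul_of]
  simp

variable [Fintype H]

/-- `Δ (r # δ_h) = ∑ l, (r # δ_{l⁻¹}) ⊗ (l • r # δ_{l h})`. -/
theorem comul_of (r : Γ) (h : H) : CoalgebraStruct.comul (R := k) (of k r h) =
    ∑ l : H, of k r l⁻¹ ⊗ₜ[k] of k (l • r) (l * h) := by
  rw [Crossed.comul_of]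
  simp

/-- `S (r # δ_h) = h⁻¹ • r⁻¹ # δ_{h⁻¹}`. -/
theorem antipode_of (r : Γ) (h : H) :
    HopfAlgebraStruct.antipode k (of k r h) = of k (h⁻¹ • r⁻¹) h⁻¹ := by
  rw [Crossed.antipode_of]
  simp

end SmashCoproduct

/-! ## Quotient data and twisted smash coproducts -/

/-- The action of `H` on the quotient of `Γ` by a normal `H`-stable subgroup. -/
@[reducible] def quotientAction {Γ H : Type*} [Group Γ] [Group H] [MulDistribMulAction H Γ]
    (N : Subgroup Γ) [N.Normal] (hN : ∀ (h : H), ∀ r ∈ N, h • r ∈ N) :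
    MulDistribMulAction H (Γ ⧸ N) where
  smul h := QuotientGroup.map N N (MulDistribMulAction.toMonoidHom Γ h) (hN h)
  one_smul x := by
    induction x using QuotientGroup.induction_on with
    | H r => exact congrArg (QuotientGroup.mk (s := N)) (one_smul H r)
  mul_smul h g x := by
    induction x using QuotientGroup.induction_on with
    | H r => exact congrArg (QuotientGroup.mk (s := N)) (mul_smul h g r)
  smul_mul h x y := map_mul (QuotientGroup.map N N (MulDistribMulAction.toMonoidHom Γ h) (hN h)) x y
  smul_one h := map_one (QuotientGroup.map N N (MulDistribMulAction.toMonoidHom Γ h) (hN h))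

/-- A quotient datum for an action of `H` on `Γ` whose first component is the whole acting group:
a normal `H`-stable subgroup `N` of `Γ` and a group morphism `Φ` from `N` to the invertible
elements of `k^H` (the algebra of functions on `H`) with
`Φ(r)(l h) = Φ(l⁻¹ • r)(h) Φ(r)(l)` and `Φ(s r s⁻¹) = Φ(r)`. -/
structure QuotientDatum (k Γ H : Type*) [Field k] [Group Γ] [Group H]
    [MulDistribMulAction H Γ] where
  N : Subgroup Γ
  normal : N.Normal
  stable : ∀ (h : H), ∀ r ∈ N, h • r ∈ N
  Φ : N →* (H → k)ˣ
  Φ_mul : ∀ (r : N) (l h : H), (Φ r : H → k) (l * h) =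
    (Φ ⟨l⁻¹ • (r : Γ), stable l⁻¹ r r.2⟩ : H → k) h * (Φ r : H → k) l
  Φ_conj : ∀ (r : N) (s : Γ), Φ ⟨s * r * s⁻¹, normal.conj_mem r r.2 s⟩ = Φ r

namespace QuotientDatum

variable {k Γ H : Type*} [Field k] [Group Γ] [Group H] [MulDistribMulAction H Γ]
variable (E : QuotientDatum k Γ H)

instance : E.N.Normal := E.normal

instance : MulDistribMulAction H (Γ ⧸ E.N) := quotientAction E.N E.stable

/-- A section `j` of the projection `Γ → Γ/N` with `j 1 = 1`. -/
def j (x : Γ ⧸ E.N) : Γ :=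
  open Classical in if x = 1 then 1 else x.out

@[simp] theorem j_one : E.j 1 = 1 := by simp [j]

@[simp] theorem mk_j (x : Γ ⧸ E.N) : (E.j x : Γ ⧸ E.N) = x := by
  unfold j
  split_ifs with h
  · exact h.symm
  · exact Quotient.out_eq' x

theorem mk_smul (l : H) (r : Γ) : ((l • r : Γ) : Γ ⧸ E.N) = l • (r : Γ ⧸ E.N) := rfl

theorem mem_of_mk {r : Γ} (h : (r : Γ ⧸ E.N) = 1) : r ∈ E.N := (QuotientGroup.eq_one_iff r).1 h

theorem σ_mem (x y : Γ ⧸ E.N) : E.j x * E.j y * (E.j (x * y))⁻¹ ∈ E.N :=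
  E.mem_of_mk (by simp)

theorem τ_mem (l : H) (x : Γ ⧸ E.N) : l • E.j x * (E.j (l • x))⁻¹ ∈ E.N :=
  E.mem_of_mk (by simp [mk_smul])

theorem s_mem (x : Γ ⧸ E.N) (h : H) : (E.j (h⁻¹ • x⁻¹))⁻¹ * h⁻¹ • (E.j x)⁻¹ ∈ E.N :=
  E.mem_of_mk (by simp [mk_smul])

/-- The value of `Φ(r)` at `h`, for `r ∈ N`. -/
def val (r : Γ) (hr : r ∈ E.N) (h : H) : k := (E.Φ ⟨r, hr⟩ : H → k) h

theorem val_congr {r s : Γ} (e : r = s) (hr : r ∈ E.N) (hs : s ∈ E.N) (h : H) :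
    E.val r hr h = E.val s hs h := by subst e; rfl

theorem val_congr_right {h g : H} (e : h = g) {r : Γ} (hr : r ∈ E.N) :
    E.val r hr h = E.val r hr g := by subst e; rfl

theorem val_one {r : Γ} (e : r = 1) (hr : r ∈ E.N) (h : H) : E.val r hr h = 1 := by
  subst e
  have : (⟨1, hr⟩ : E.N) = 1 := rfl
  simp [val, this]

theorem val_mul (r s : Γ) (hr : r ∈ E.N) (hs : s ∈ E.N) (hrs : r * s ∈ E.N) (h : H) :
    E.val (r * s) hrs h = E.val r hr h * E.val s hs h := by
  have : (⟨r * s, hrs⟩ : E.N) = ⟨r, hr⟩ * ⟨s, hs⟩ := rfl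
  unfold val
  rw [this, map_mul]
  rfl

theorem val_ne_zero (r : Γ) (hr : r ∈ E.N) (h : H) : E.val r hr h ≠ 0 := by
  intro h0
  have h1 := E.val_mul r r⁻¹ hr (E.N.inv_mem hr) (by simp) h
  rw [E.val_one (by simp), h0, zero_mul] at h1
  exact one_ne_zero h1

theorem val_conj (s r : Γ) (hr : r ∈ E.N) (hs : s * r * s⁻¹ ∈ E.N) (h : H) :
    E.val (s * r * s⁻¹) hs h = E.val r hr h := by
  unfold val
  rw [E.Φ_conj ⟨r, hr⟩ s]

/-- The cocycle law, in multiplicative form. -/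
theorem val_cocycle (r : Γ) (hr : r ∈ E.N) (q g : H) (hq : q • r ∈ E.N) :
    E.val r hr g = E.val (q • r) hq (q * g) * E.val r hr q⁻¹ := by
  have := E.Φ_mul ⟨r, hr⟩ q⁻¹ (q * g)
  simpa [val] using this

theorem val_at_one (r : Γ) (hr : r ∈ E.N) : E.val r hr 1 = 1 := by
  have h1 := E.val_cocycle r hr 1 1 (E.stable _ _ hr)
  have e := E.val_congr (one_smul H r) (E.stable _ _ hr) hr (1 * 1)
  rw [e] at h1
  simp only [mul_one, inv_one] at h1
  exact (mul_eq_left₀ (E.val_ne_zero r hr 1)).1 h1.symm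

/-- The cocycles attached to a quotient datum:
`σ(x, y) = Φ(j(x) j(y) j(x y)⁻¹)`, `τ(l, x) = Φ((l • j(x)) j(l • x)⁻¹)` and
`s(x, h) = Φ(j(h⁻¹ • x⁻¹)⁻¹ (h⁻¹ • j(x)⁻¹))(h⁻¹)`. -/
def cocycleDatum : CocycleDatum k (Γ ⧸ E.N) H where
  σ x y h := E.val (E.j x * E.j y * (E.j (x * y))⁻¹) (E.σ_mem x y) h
  τ l x h := E.val (l • E.j x * (E.j (l • x))⁻¹) (E.τ_mem l x) h
  s x h := E.val ((E.j (h⁻¹ • x⁻¹))⁻¹ * h⁻¹ • (E.j x)⁻¹) (E.s_mem x h) h⁻¹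
  σ_one_left x h := E.val_one (by simp) _ _
  σ_one_right x h := E.val_one (by simp) _ _
  σ_assoc x y z h := by
    rw [← E.val_conj (E.j x) _ (E.σ_mem y z) (E.normal.conj_mem _ (E.σ_mem y z) _),
      ← E.val_mul _ _ _ _ (E.N.mul_mem (E.σ_mem _ _) (E.σ_mem _ _)),
      ← E.val_mul _ _ _ _ (E.N.mul_mem (E.normal.conj_mem _ (E.σ_mem y z) _) (E.σ_mem _ _))]
    refine E.val_congr ?_ _ _ _
    rw [mul_assoc x y z]
    group
  σ_counit x y := E.val_at_one _ _
  τ_one_elt l h := E.val_one (by simp) _ _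
  τ_one_left x h := E.val_one (by simp) _ _
  τ_counit l x := E.val_at_one _ _
  τ_coassoc q m x g := by
    have hA := E.τ_mem m x
    have hq := E.stable q _ hA
    rw [E.val_cocycle _ hA q g hq]
    have e : E.val ((q * m) • E.j x * (E.j ((q * m) • x))⁻¹) (E.τ_mem (q * m) x) (q * g) =
        E.val (q • (m • E.j x * (E.j (m • x))⁻¹)) hq (q * g) *
          E.val (q • E.j (m • x) * (E.j (q • m • x))⁻¹) (E.τ_mem q (m • x)) (q * g) := by
      rw [← E.val_mul _ _ _ _ (E.N.mul_mem hq (E.τ_mem _ _))]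
      refine E.val_congr ?_ _ _ _
      simp [mul_smul, smul_mul']
    rw [e]
    ring
  τ_mul l x y h := by
    have hS := E.σ_mem x y
    have hl := E.stable l _ hS
    have hB := E.τ_mem l y
    rw [E.val_cocycle _ hS l h hl]
    have e : E.val (l • (E.j x * E.j y * (E.j (x * y))⁻¹)) hl (l * h) *
        E.val (l • E.j (x * y) * (E.j (l • (x * y)))⁻¹) (E.τ_mem l (x * y)) (l * h) =
        E.val (l • E.j x * (E.j (l • x))⁻¹) (E.τ_mem l x) (l * h) *
        E.val (l • E.j y * (E.j (l • y))⁻¹) hB (l * h) *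
        E.val (E.j (l • x) * E.j (l • y) * (E.j (l • x * l • y))⁻¹) (E.σ_mem _ _) (l * h) := by
      rw [← E.val_conj (E.j (l • x)) _ hB (E.normal.conj_mem _ hB _),
        ← E.val_mul _ _ _ _ (E.N.mul_mem hl (E.τ_mem _ _)),
        ← E.val_mul _ _ _ _ (E.N.mul_mem (E.τ_mem _ _) (E.normal.conj_mem _ hB _)),
        ← E.val_mul _ _ _ _ (E.N.mul_mem (E.N.mul_mem (E.τ_mem _ _)
          (E.normal.conj_mem _ hB _)) (E.σ_mem _ _))]
      refine E.val_congr ?_ _ _ _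
      simp only [smul_mul', smul_inv']
      group
    linear_combination E.val _ hS l⁻¹ * e
  s_left l x := by
    have hT := E.τ_mem l x
    have hS := E.s_mem x l⁻¹
    have hM := E.σ_mem (l • x⁻¹) (l • x)
    have hc := E.normal.conj_mem _ hM (E.j (l • x))
    rw [E.val_congr_right (inv_inv l), ← E.val_conj (E.j (l • x)) _ hM hc, mul_right_comm,
      ← E.val_mul _ _ _ _ (E.N.mul_mem hT hc),
      ← E.val_mul _ _ _ _ (E.N.mul_mem (E.N.mul_mem hT hc) hS)]
    refine E.val_one ?_ _ _
    rw [← smul_mul', inv_mul_cancel, smul_one, j_one, inv_inv, smul_inv' l (E.j x)]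
    group
  s_right l x := by
    have hT := E.τ_mem l x
    have hS := E.s_mem (l • x) l
    have hM := E.σ_mem x x⁻¹
    have hU := E.stable l⁻¹ _ hT
    have h1 := E.val_cocycle _ hU l 1 (E.stable l _ hU)
    rw [E.val_at_one, mul_one, E.val_congr (smul_inv_smul l _) _ hT] at h1
    rw [mul_assoc, mul_comm (E.val _ hS _), ← E.val_mul _ _ _ _ (E.N.mul_mem hM hS), h1]
    congr 1
    refine E.val_congr ?_ _ _ _
    rw [mul_inv_cancel, j_one, ← smul_inv', inv_smul_smul, smul_mul', inv_smul_smul]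
    group

/-- The Hopf algebra `k[Γ/N] ⋊_Φ k^H` of a quotient datum `(H, N, Φ)`. -/
abbrev Twisted : Type _ := Crossed E.cocycleDatum

end QuotientDatum


/-! ## The infinite dihedral group and the families of quotients -/

/-- The group `ℤ/2`, written multiplicatively. -/
abbrev C₂ : Type := Multiplicative (ZMod 2)

/-- The generator `h` of `ℤ/2`. -/
def C₂.gen : C₂ := Multiplicative.ofAdd 1

/-- The morphism `ℤ/2 → G` defined by an element of square `1`. -/
def C₂.lift {G : Type*} [Group G] (g : G) (hg : g * g = 1) : C₂ →* G where
  toFun t := if t = 1 then 1 else g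
  map_one' := if_pos rfl
  map_mul' t u := by
    have key : ∀ t u : C₂, (t = 1 ∧ u = 1 ∧ t * u = 1) ∨ (t ≠ 1 ∧ u = 1 ∧ t * u ≠ 1) ∨
        (t = 1 ∧ u ≠ 1 ∧ t * u ≠ 1) ∨ (t ≠ 1 ∧ u ≠ 1 ∧ t * u = 1) := by decide
    rcases key t u with ⟨h1, h2, h3⟩ | ⟨h1, h2, h3⟩ | ⟨h1, h2, h3⟩ | ⟨h1, h2, h3⟩ <;>
      simp [h1, h2, h3, hg]

/-- The action of `ℤ/2` on `Γ` in which the generator acts by the involutive endomorphism `f`. -/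
@[reducible] def involutionAction {Γ : Type*} [Group Γ] (f : Γ →* Γ) (hf : ∀ x, f (f x) = x) :
    MulDistribMulAction C₂ Γ where
  smul t x := if t = 1 then x else f x
  one_smul x := if_pos rfl
  mul_smul t u x := by
    have key : ∀ t u : C₂, (t = 1 ∧ u = 1 ∧ t * u = 1) ∨ (t ≠ 1 ∧ u = 1 ∧ t * u ≠ 1) ∨
        (t = 1 ∧ u ≠ 1 ∧ t * u ≠ 1) ∨ (t ≠ 1 ∧ u ≠ 1 ∧ t * u = 1) := by decide
    change (if t * u = 1 then x else f x) =
      if t = 1 then (if u = 1 then x else f x) else f (if u = 1 then x else f x)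
    rcases key t u with ⟨h1, h2, h3⟩ | ⟨h1, h2, h3⟩ | ⟨h1, h2, h3⟩ | ⟨h1, h2, h3⟩ <;>
      simp [h1, h2, h3, hf]
  smul_mul t x y := by
    change (if t = 1 then x * y else f (x * y)) =
      (if t = 1 then x else f x) * (if t = 1 then y else f y)
    split_ifs <;> simp
  smul_one t := by
    change (if t = 1 then 1 else f 1) = (1 : Γ)
    simp

/-- The infinite dihedral group `D_∞ = ℤ/2 ∗ ℤ/2`, a free product of groups. -/
abbrev DInf : Type := Monoid.Coprod C₂ C₂

namespace DInf

/-- The first generator `g₀`. -/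
def g₀ : DInf := Monoid.Coprod.inl C₂.gen

/-- The second generator `g₁`. -/
def g₁ : DInf := Monoid.Coprod.inr C₂.gen

/-- The action of `ℤ/2` on `ℤ/2 ∗ ℤ/2` whose generator exchanges `g₀` and `g₁`. -/
instance : MulDistribMulAction C₂ DInf :=
  involutionAction (Monoid.Coprod.swap C₂ C₂) Monoid.Coprod.swap_swap

theorem gen_smul_g₀ : C₂.gen • g₀ = g₁ := rfl

theorem gen_smul_g₁ : C₂.gen • g₁ = g₀ := rfl

theorem g₀_mul_self : g₀ * g₀ = 1 := by
  unfold g₀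
  rw [← map_mul, show C₂.gen * C₂.gen = 1 by decide, map_one]

theorem g₁_mul_self : g₁ * g₁ = 1 := by
  unfold g₁
  rw [← map_mul, show C₂.gen * C₂.gen = 1 by decide, map_one]

theorem g₀_inv : g₀⁻¹ = g₀ := inv_eq_of_mul_eq_one_left g₀_mul_self

theorem g₁_inv : g₁⁻¹ = g₁ := inv_eq_of_mul_eq_one_left g₁_mul_self

/-- Every element of `ℤ/2 ∗ ℤ/2` is obtained from `1` by left multiplications by `g₀`, `g₁`. -/
theorem induction {p : DInf → Prop} (h1 : p 1) (h₀ : ∀ x, p x → p (g₀ * x))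
    (h₁ : ∀ x, p x → p (g₁ * x)) (x : DInf) : p x := by
  have key : ∀ t : C₂, t = 1 ∨ t = C₂.gen := by decide
  induction x using Monoid.Coprod.induction_on' with
  | one => exact h1
  | inl_mul t x hx =>
    rcases key t with rfl | rfl
    · simpa using hx
    · exact h₀ x hx
  | inr_mul t x hx =>
    rcases key t with rfl | rfl
    · simpa using hx
    · exact h₁ x hx

/-- The rotation `g₀ g₁`. -/
def rot : DInf := g₀ * g₁

theorem g₀_conj_rot : g₀ * rot * g₀⁻¹ = rot⁻¹ := by
  unfold rot
  rw [mul_inv_rev, g₀_inv, g₁_inv, ← mul_assoc, g₀_mul_self, one_mul]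

theorem g₁_conj_rot : g₁ * rot * g₁⁻¹ = rot⁻¹ := by
  unfold rot
  rw [mul_inv_rev, g₀_inv, g₁_inv, mul_assoc, mul_assoc, g₁_mul_self, mul_one]

/-- The morphism to a dihedral group with `g₀ ↦ s`, `g₁ ↦ s r`, hence `g₀ g₁ ↦ r`. -/
def toDihedral (n : ℕ) : DInf →* DihedralGroup n :=
  Monoid.Coprod.lift (C₂.lift (DihedralGroup.sr 0) (DihedralGroup.sr_mul_self 0))
    (C₂.lift (DihedralGroup.sr 1) (DihedralGroup.sr_mul_self 1))

theorem toDihedral_rot (n : ℕ) : toDihedral n rot = DihedralGroup.r 1 := by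
  have h : (C₂.gen : C₂) ≠ 1 := by decide
  simp [toDihedral, rot, g₀, g₁, C₂.lift, h]

theorem rot_zpow_injective : Function.Injective fun n : ℤ => rot ^ n := by
  intro a b hab
  have h := congrArg (toDihedral 0) hab
  simp only [map_zpow, toDihedral_rot, DihedralGroup.r_one_zpow] at h
  simpa using h

theorem conj_eq (s : DInf) : ∀ z ∈ Subgroup.zpowers rot, s * z * s⁻¹ = z ∨ s * z * s⁻¹ = z⁻¹ := by
  have aux : ∀ g : DInf, g * rot * g⁻¹ = rot⁻¹ → ∀ x : DInf,
      (∀ z ∈ Subgroup.zpowers rot, x * z * x⁻¹ = z ∨ x * z * x⁻¹ = z⁻¹) →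
      ∀ z ∈ Subgroup.zpowers rot, g * x * z * (g * x)⁻¹ = z ∨ g * x * z * (g * x)⁻¹ = z⁻¹ := by
    intro g hg x hx z hz
    have e : g * x * z * (g * x)⁻¹ = g * (x * z * x⁻¹) * g⁻¹ := by group
    have inv : g * z * g⁻¹ = z⁻¹ := by
      obtain ⟨n, rfl⟩ := hz
      change g * rot ^ n * g⁻¹ = (rot ^ n)⁻¹
      rw [← conj_zpow, hg, inv_zpow]
    have inv' : g * z⁻¹ * g⁻¹ = z := by rw [← conj_inv, inv, inv_inv]
    rw [e]
    rcases hx z hz with h | h <;> rw [h]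
    · exact Or.inr inv
    · exact Or.inl inv'
  induction s using DInf.induction with
  | h1 => intro z _; simp
  | h₀ x hx => exact aux g₀ g₀_conj_rot x hx
  | h₁ x hx => exact aux g₁ g₁_conj_rot x hx

theorem smul_eq (t : C₂) : ∀ z ∈ Subgroup.zpowers rot, t • z = z ∨ t • z = z⁻¹ := by
  have key : ∀ t : C₂, t = 1 ∨ t = C₂.gen := by decide
  have hr : C₂.gen • rot = rot⁻¹ := by
    unfold rot
    rw [smul_mul', gen_smul_g₀, gen_smul_g₁, mul_inv_rev, g₀_inv, g₁_inv]
  rintro z ⟨n, rfl⟩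
  rcases key t with rfl | rfl
  · exact Or.inl (one_smul _ _)
  · right
    change C₂.gen • rot ^ n = (rot ^ n)⁻¹
    rw [smul_zpow', hr, inv_zpow]

/-- The subgroup `N_m = ⟨(g₀ g₁)^m⟩`, for `m ≥ 1`. -/
def N (m : ℕ+) : Subgroup DInf := Subgroup.zpowers ((g₀ * g₁) ^ (m : ℕ))

theorem N_le (m : ℕ+) : N m ≤ Subgroup.zpowers rot :=
  Subgroup.zpowers_le.2 (Subgroup.pow_mem _ (Subgroup.mem_zpowers rot) _)

instance N_normal (m : ℕ+) : (N m).Normal where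
  conj_mem z hz s := by
    rcases conj_eq s z (N_le m hz) with h | h <;> rw [h]
    · exact hz
    · exact (N m).inv_mem hz

theorem N_stable (m : ℕ+) (t : C₂) : ∀ z ∈ N m, t • z ∈ N m := by
  intro z hz
  rcases smul_eq t z (N_le m hz) with h | h <;> rw [h]
  · exact hz
  · exact (N m).inv_mem hz

/-- The induced action of `ℤ/2` on `(ℤ/2 ∗ ℤ/2)/N_m`. -/
instance (m : ℕ+) : MulDistribMulAction C₂ (DInf ⧸ N m) := quotientAction (N m) (N_stable m)

theorem N_exists (m : ℕ+) (z : N m) : ∃ n : ℤ, ((g₀ * g₁) ^ (m : ℕ)) ^ n = (z : DInf) := z.2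

theorem N_injective (m : ℕ+) :
    Function.Injective fun n : ℤ => ((g₀ * g₁) ^ (m : ℕ)) ^ n := by
  intro a b hab
  have h : rot ^ ((m : ℤ) * a) = rot ^ ((m : ℤ) * b) := by
    have hab' : (rot ^ (m : ℕ)) ^ a = (rot ^ (m : ℕ)) ^ b := hab
    simpa only [zpow_mul, zpow_natCast] using hab'
  have hm : (m : ℤ) ≠ 0 := by exact_mod_cast m.ne_zero
  exact mul_left_cancel₀ hm (rot_zpow_injective h)

/-- The exponent `n` of an element `((g₀ g₁)^m)^n` of `N_m`. -/
def expo (m : ℕ+) (z : N m) : ℤ := (N_exists m z).choose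

theorem expo_eq (m : ℕ+) (z : N m) (n : ℤ) (hz : ((g₀ * g₁) ^ (m : ℕ)) ^ n = (z : DInf)) :
    expo m z = n :=
  N_injective m ((N_exists m z).choose_spec.trans hz.symm)

theorem expo_spec (m : ℕ+) (z : N m) : ((g₀ * g₁) ^ (m : ℕ)) ^ expo m z = (z : DInf) :=
  (N_exists m z).choose_spec

variable (k : Type*) [Field k]

/-- The non-trivial character `χ` of `ℤ/2` with values in `{1, -1}`, as an invertible element of
`k^{ℤ/2}`. -/
def χ : (C₂ → k)ˣ where
  val t := if t = 1 then 1 else -1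
  inv t := if t = 1 then 1 else -1
  val_inv := by ext t; by_cases h : t = 1 <;> simp [h]
  inv_val := by ext t; by_cases h : t = 1 <;> simp [h]

theorem χ_inv : (χ k)⁻¹ = χ k := rfl

theorem χ_mul (l h : C₂) : (χ k : C₂ → k) (l * h) = (χ k : C₂ → k) h * (χ k : C₂ → k) l := by
  have key : ∀ t u : C₂, (t = 1 ∧ u = 1 ∧ t * u = 1) ∨ (t ≠ 1 ∧ u = 1 ∧ t * u ≠ 1) ∨
      (t = 1 ∧ u ≠ 1 ∧ t * u ≠ 1) ∨ (t ≠ 1 ∧ u ≠ 1 ∧ t * u = 1) := by decide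
  rcases key l h with ⟨h1, h2, h3⟩ | ⟨h1, h2, h3⟩ | ⟨h1, h2, h3⟩ | ⟨h1, h2, h3⟩ <;>
    simp [χ, h1, h2, h3]

/-- The group morphism `Φ_m : N_m → (k^{ℤ/2})ˣ`, `((g₀ g₁)^m)^n ↦ χ^n`. -/
def Φ (m : ℕ+) : N m →* (C₂ → k)ˣ where
  toFun z := χ k ^ expo m z
  map_one' := by
    rw [expo_eq m 1 0 (by simp), zpow_zero]
  map_mul' y z := by
    rw [expo_eq m (y * z) (expo m y + expo m z)
      (by rw [zpow_add, expo_spec, expo_spec, Subgroup.coe_mul]), zpow_add]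

theorem Φ_apply (m : ℕ+) (z : N m) (n : ℤ) (hz : ((g₀ * g₁) ^ (m : ℕ)) ^ n = (z : DInf)) :
    Φ k m z = χ k ^ n :=
  congrArg (χ k ^ ·) (expo_eq m z n hz)

/-- `Φ_m` is the morphism that sends the generator `(g₀ g₁)^m` to `χ`. -/
theorem Φ_gen (m : ℕ+) : Φ k m ⟨(g₀ * g₁) ^ (m : ℕ), Subgroup.mem_zpowers _⟩ = χ k := by
  rw [Φ_apply k m _ 1 (by simp), zpow_one]

theorem Φ_cases (m : ℕ+) (z : N m) : Φ k m z = 1 ∨ Φ k m z = χ k := by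
  have h2 : χ k * χ k = 1 := by rw [mul_eq_one_iff_eq_inv, χ_inv]
  obtain ⟨n, hn⟩ := N_exists m z
  rw [Φ_apply k m z n hn]
  rcases Int.even_or_odd n with ⟨i, rfl⟩ | ⟨i, rfl⟩
  · left
    rw [← two_mul, zpow_mul, zpow_two, h2, one_zpow]
  · right
    rw [zpow_add, zpow_mul, zpow_two, h2, one_zpow, one_mul, zpow_one]

theorem Φ_inv (m : ℕ+) (z : N m) : Φ k m z⁻¹ = Φ k m z := by
  rw [map_inv]
  rcases Φ_cases k m z with h | h <;> rw [h]
  · exact inv_one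
  · exact χ_inv k

/-- The quotient datum `(ℤ/2, N_m, Φ_m)`. -/
def datum (m : ℕ+) : QuotientDatum k DInf C₂ where
  N := N m
  normal := N_normal m
  stable := N_stable m
  Φ := Φ k m
  Φ_mul z l h := by
    have e : Φ k m ⟨l⁻¹ • (z : DInf), N_stable m l⁻¹ z z.2⟩ = Φ k m z := by
      rcases smul_eq l⁻¹ z (N_le m z.2) with h | h
      · exact congrArg _ (Subtype.ext h)
      · rw [← Φ_inv k m z]
        exact congrArg _ (Subtype.ext h)
    rw [e]
    rcases Φ_cases k m z with h' | h' <;> rw [h']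
    · simp
    · exact χ_mul k l h
  Φ_conj z s := by
    rcases conj_eq s z (N_le m z.2) with h | h
    · exact congrArg _ (Subtype.ext h)
    · rw [← Φ_inv k m z]
      exact congrArg _ (Subtype.ext h)

end DInf

/-- The Hopf algebra `k[ℤ/2 ∗ ℤ/2] ⋊ k^{ℤ/2}`. -/
abbrev HopfDInf (k : Type*) [Field k] : Type _ := SmashCoproduct k DInf C₂

/-- The Hopf algebra `A(m) = k[(ℤ/2 ∗ ℤ/2)/N_m] ⋊ k^{ℤ/2}`. -/
abbrev HopfA (k : Type*) [Field k] (m : ℕ+) : Type _ := SmashCoproduct k (DInf ⧸ DInf.N m) C₂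

/-- The Hopf algebra `B(m) = k[(ℤ/2 ∗ ℤ/2)/N_m] ⋊_{Φ_m} k^{ℤ/2}`. -/
abbrev HopfB (k : Type*) [Field k] (m : ℕ+) : Type _ := (DInf.datum k m).Twisted

/-- The automorphism of the dihedral group that exchanges the reflections `s` and `s r`
(the images of `g₀` and `g₁`). -/
def dihedralFlip (n : ℕ) : DihedralGroup n →* DihedralGroup n where
  toFun
    | .r i => .r (-i)
    | .sr i => .sr (1 - i)
  map_one' := congrArg DihedralGroup.r neg_zero
  map_mul' := by
    rintro (i | i) (j | j)
    · simp only [DihedralGroup.r_mul_r]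
      congr 1
      ring
    · simp only [DihedralGroup.r_mul_sr]
      congr 1
      ring
    · simp only [DihedralGroup.sr_mul_r]
      congr 1
      ring
    · simp only [DihedralGroup.sr_mul_sr]
      congr 1
      ring

/-- The action of `ℤ/2` on the dihedral group by exchange of the two generating reflections. -/
instance (n : ℕ) : MulDistribMulAction C₂ (DihedralGroup n) :=
  involutionAction (dihedralFlip n) (by
    rintro (i | i)
    · exact congrArg DihedralGroup.r (neg_neg i)
    · exact congrArg DihedralGroup.sr (sub_sub_cancel 1 i))

/-- `L` is a non-trivial Hopf algebra quotient of `A`: there is a surjective, non-injective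
morphism of Hopf algebras `A → L`, and `dim L > 1`.  (A bialgebra morphism between Hopf algebras
automatically commutes with the antipodes.) -/
def IsNontrivialHopfQuotient (k A L : Type*) [Field k] [Ring A] [HopfAlgebra k A] [Ring L]
    [HopfAlgebra k L] : Prop :=
  ∃ π : A →ₐc[k] L, Function.Surjective π ∧ ¬ Function.Injective π ∧ 1 < Module.rank k L

end

/-!
Let `π : k[Γ] ⋊ k^H → L` be a surjective morphism of Hopf algebras. If `π` kills `1 # δ_h` for all
`h ≠ 1`, then `L` is spanned by the group-like elements `π (r # δ_1)`, hence is the group algebra of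
a quotient of `Γ`. If `π` kills no `1 # δ_h`, then comparing the components of `Δ (π (r # δ_h))`
shows that the elements `r` with `π (r # δ_1) = π (1 # δ_1)` form a normal `H`-stable subgroup `N`,
that `π (r # δ_h) = Φ(r)(h) π (1 # δ_h)` for `r ∈ N`, and that `L ≃ k[Γ/N] ⋊_Φ k^H`.

For `Γ = D_∞` and `H = ℤ/2` one of the two cases always occurs. A normal stable subgroup is `1`,
`D_∞` or some `N_m`. In the first case `π` is injective. In the second `L` is `k^{ℤ/2}` as
`char k ≠ 2`, again spanned by group-likes. In the third, conjugation by `g₀` inverts the generator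
of `N_m`, so `Φ` takes values in square roots of `1` there and is `1` or `Φ_m`.
-/

/-- The scalars `ψ₁(v) ⋯ ψₙ(v)` are the values at `v` of linear functionals when `v` is group-like,
so that the linear independence of characters of a free monoid applies. -/
theorem linearIndependent_of_comul {k V ι : Type*} [Field k] [AddCommGroup V] [Module k V]
    {v : ι → V} (hv : Function.Injective v) (δ : V →ₗ[k] V ⊗[k] V)
    (hδ : ∀ i, δ (v i) = v i ⊗ₜ v i) (ε : Module.Dual k V) (hε : ∀ i, ε (v i) = 1) :
    LinearIndependent k v := by
  let χ (i : ι) : FreeMonoid (Module.Dual k V) →* k := FreeMonoid.lift fun ψ => ψ (v i)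
  have hχ : Function.Injective χ := fun i j hij => hv <| Module.eval_apply_injective k <|
    LinearMap.ext fun ψ => by simpa [χ] using DFunLike.congr_fun hij (FreeMonoid.of ψ)
  have hΨ (w : FreeMonoid (Module.Dual k V)) : ∃ Ψ : Module.Dual k V, ∀ i, Ψ (v i) = χ i w := by
    induction w using FreeMonoid.inductionOn' with
    | one => exact ⟨ε, fun i => by simp [hε]⟩
    | of_mul ψ w ih =>
      obtain ⟨Ψ, hΨ⟩ := ih
      exact ⟨LinearMap.mul' k k ∘ₗ TensorProduct.map ψ Ψ ∘ₗ δ, fun i => by simp [hδ, hΨ, χ]⟩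
  choose Ψ hΨ using hΨ
  have h : LinearMap.pi Ψ ∘ v = fun i => ⇑(χ i) := funext fun i => funext fun w => hΨ w i
  refine LinearIndependent.of_comp (LinearMap.pi Ψ) ?_
  rw [h]
  exact (linearIndependent_monoidHom (FreeMonoid (Module.Dual k V)) k).comp χ hχ

section GroupLike

variable {k L : Type*} [Field k] [Ring L] [HopfAlgebra k L]

theorem nonempty_bialgEquiv_monoidAlgebra_groupLike
    (h : Submodule.span k (Set.range (GroupLike.val : GroupLike k L → L)) = ⊤) :
    Nonempty (L ≃ₐc[k] MonoidAlgebra k (GroupLike k L)) := by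
  have hφ (x : MonoidAlgebra k (GroupLike k L)) :
      MonoidAlgebra.liftGroupLikeBialgHom x =
        Finsupp.linearCombination k GroupLike.val x.coeff := by
    simp [MonoidAlgebra.lift_apply, Finsupp.linearCombination_apply]
  refine ⟨(BialgEquiv.ofBijective MonoidAlgebra.liftGroupLikeBialgHom
    ⟨fun x y hxy => ?_, fun y => ?_⟩).symm⟩
  · rw [hφ, hφ] at hxy
    exact MonoidAlgebra.coeff_injective (linearIndep_groupLikeVal hxy)
  · have hy : y ∈ Submodule.span k (Set.range GroupLike.val) := h ▸ Submodule.mem_top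
    obtain ⟨c, rfl⟩ := Finsupp.mem_span_range_iff_exists_finsupp.1 hy
    exact ⟨.ofCoeff c, hφ _⟩

/-- A monoid morphism with group-like values, as a morphism to the monoid of group-like elements. -/
def toGroupLike {M : Type*} [Monoid M] (u : M →* L) (hu : ∀ g, IsGroupLikeElem k (u g)) :
    M →* GroupLike k L where
  toFun g := ⟨u g, hu g⟩
  map_one' := GroupLike.val_injective u.map_one
  map_mul' g h := GroupLike.val_injective (u.map_mul g h)

theorem toGroupLike_surjective {M : Type*} [Monoid M] {u : M →* L}
    (hu : ∀ g, IsGroupLikeElem k (u g)) (h : Submodule.span k (Set.range u) = ⊤) :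
    Function.Surjective (toGroupLike u hu) := by
  intro b
  by_contra hb
  refine linearIndep_groupLikeVal.notMem_span_image (s := Set.range (toGroupLike u hu)) hb ?_
  rw [← Set.range_comp]
  exact h ▸ Submodule.mem_top

end GroupLike

noncomputable section

namespace Crossed

variable {k Q H : Type*} [Field k] [Group Q] [Group H] [MulDistribMulAction H Q]
variable {D : CocycleDatum k Q H}

theorem span_of : Submodule.span k (Set.range fun p : Q × H => of D p.1 p.2) = ⊤ := by
  have h := (Finsupp.basisSingleOne (R := k) (ι := Q × H)).span_eq
  simp only [Finsupp.coe_basisSingleOne] at h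
  exact h

theorem of_ne_zero (x : Q) (h : H) : of D x h ≠ 0 :=
  Finsupp.single_ne_zero.2 one_ne_zero

theorem of_injective (h : H) : Function.Injective fun x => of D x h :=
  fun _ _ hxy => congrArg Prod.fst (Finsupp.single_left_injective (one_ne_zero (α := k)) hxy)

instance [Finite Q] [Finite H] : Module.Finite k (Crossed D) :=
  inferInstanceAs (Module.Finite k ((Q × H) →₀ k))

theorem one_lt_rank [Nontrivial H] : 1 < Module.rank k (Crossed D) := by
  have h : Module.rank k (Crossed D) = _ := rank_finsupp_self k (Q × H)
  rw [h, Cardinal.one_lt_lift_iff, Cardinal.one_lt_iff_nontrivial]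
  infer_instance

theorem surjective_of_forall_of_mem_range {L : Type*} [AddCommGroup L] [Module k L]
    (π : L →ₗ[k] Crossed D) (hπ : ∀ x h, of D x h ∈ LinearMap.range π) :
    Function.Surjective π := by
  rw [← LinearMap.range_eq_top, eq_top_iff, ← span_of, Submodule.span_le]
  rintro _ ⟨⟨x, h⟩, rfl⟩
  exact hπ x h

theorem span_map_of {L : Type*} [AddCommGroup L] [Module k L] {π : Crossed D →ₗ[k] L}
    (hπ : Function.Surjective π) :
    Submodule.span k (Set.range fun p : Q × H => π (of D p.1 p.2)) = ⊤ := by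
  rw [Set.range_comp' π, ← Submodule.map_span, span_of, Submodule.map_top,
    LinearMap.range_eq_top.2 hπ]

theorem injective_of_linearIndependent {L : Type*} [AddCommGroup L] [Module k L]
    {π : Crossed D →ₗ[k] L} (h : LinearIndependent k fun p : Q × H => π (of D p.1 p.2)) :
    Function.Injective π := by
  have hπ : π = lin D fun x h => π (of D x h) := hom_ext fun x h => by rw [lin_of]
  rw [hπ]
  exact h

theorem _root_.CocycleDatum.σ_inv_ne_zero (D : CocycleDatum k Q H) (x : Q) (h : H) :
    D.σ x x⁻¹ h ≠ 0 := fun h0 => by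
  simpa [h0] using D.s_right h⁻¹ x

variable [DecidableEq H]

theorem of_mul_of_one (x : Q) (h g : H) :
    of D x h * of D 1 g = if h = g then of D x h else 0 := by
  rw [of_mul_of, mul_one, D.σ_one_right, one_smul]

variable [Fintype H]

/-- Multiplication by `(1 # δ_{l⁻¹}) ⊗ (1 # δ_g)` selects one term of the coproduct. -/
theorem comul_of_mul (x : Q) (h l g : H) :
    Coalgebra.comul (R := k) (of D x h) * (of D 1 l⁻¹ ⊗ₜ of D 1 g) =
      if l * h = g then D.τ l x g • (of D x l⁻¹ ⊗ₜ of D (l • x) g) else 0 := by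
  rw [comul_of, Finset.sum_mul, Finset.sum_eq_single l]
  · rw [Algebra.TensorProduct.tmul_mul_tmul, smul_mul_assoc, of_mul_of_one, of_mul_of_one,
      if_pos rfl]
    split_ifs with hg
    · rw [hg, TensorProduct.tmul_smul]
    · rw [smul_zero, TensorProduct.tmul_zero]
  · intro m _ hm
    rw [Algebra.TensorProduct.tmul_mul_tmul, of_mul_of_one, if_neg (by simpa using hm),
      TensorProduct.zero_tmul]
  · simp

section

variable {L : Type*} [Ring L] [Bialgebra k L] (π : Crossed D →ₐc[k] L)

theorem comul_map_of_mul (x : Q) (h l g : H) :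
    Coalgebra.comul (R := k) (π (of D x h)) * (π (of D 1 l⁻¹) ⊗ₜ π (of D 1 g)) =
      if l * h = g then D.τ l x g • (π (of D x l⁻¹) ⊗ₜ π (of D (l • x) g)) else 0 := by
  let P : Crossed D →ₐ[k] L := π
  have hmap := congrArg (Algebra.TensorProduct.map P P) (comul_of_mul x h l g)
  rw [map_mul] at hmap
  rw [← CoalgHomClass.map_comp_comul_apply π]
  refine hmap.trans ?_
  rw [apply_ite (Algebra.TensorProduct.map P P), map_smul, map_zero]
  rfl

theorem counit_map_of (x : Q) (h : H) :
    Coalgebra.counit (R := k) (π (of D x h)) = if h = 1 then 1 else 0 :=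
  (CoalgHomClass.counit_comp_apply π _).trans (counit_of x h)

variable {π}

theorem map_of_one_ne_zero : π (of D 1 1) ≠ 0 := fun h => by
  simpa [h] using counit_map_of π 1 1

theorem map_of_ne_zero {h : H} (h0 : π (of D 1 h) ≠ 0) (x : Q) : π (of D x h) ≠ 0 := fun hx => by
  have h1 : π (of D x h * of D x⁻¹ h) = 0 := by rw [map_mul, hx, zero_mul]
  rw [of_mul_of, if_pos rfl, mul_inv_cancel, map_smul] at h1
  exact (smul_eq_zero.1 h1).elim (D.σ_inv_ne_zero x h) h0

theorem linearIndependent_map_of_one (h1 : Function.Injective fun x => π (of D x 1)) :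
    LinearIndependent k fun x => π (of D x 1) := by
  refine linearIndependent_of_comul h1
    (LinearMap.mulRight k (π (of D 1 1) ⊗ₜ π (of D 1 1)) ∘ₗ Coalgebra.comul) (fun x => ?_)
    Coalgebra.counit fun x => (counit_map_of π x 1).trans (if_pos rfl)
  simpa [D.τ_one_left] using comul_map_of_mul π x 1 1 1

/-- The terms `π (x # δ_1) ⊗ π (x # δ_g)` of `Δ (π (x # δ_g))` show that the `π (x # δ_g)` are
independent as soon as the `π (x # δ_1)` are. -/
theorem injective_of_injective (h1 : Function.Injective fun x => π (of D x 1))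
    (h0 : ∀ h, π (of D 1 h) ≠ 0) : Function.Injective π := by
  classical
  obtain ⟨G, hG⟩ := LinearMap.exists_leftInverse_of_injective _
    (LinearMap.ker_eq_bot.2 (linearIndependent_map_of_one h1))
  have hG (x : Q) : G (π (of D x 1)) = Finsupp.single x 1 := by
    simpa using LinearMap.congr_fun hG (Finsupp.single x 1)
  let T (p : Q × H) : L →ₗ[k] L := (TensorProduct.lid k L).toLinearMap ∘ₗ
    (Finsupp.lapply p.1 ∘ₗ G).rTensor L ∘ₗ
    LinearMap.mulRight k (π (of D 1 1) ⊗ₜ π (of D 1 p.2)) ∘ₗ Coalgebra.comul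
  have hT : LinearMap.pi T ∘ (fun q : Q × H => π (of D q.1 q.2)) =
      fun q => Pi.single q (π (of D q.1 q.2)) := by
    ext ⟨x, h⟩ ⟨y, g⟩
    have hc := comul_map_of_mul π x h 1 g
    rw [inv_one, one_mul, one_smul, D.τ_one_left, one_smul] at hc
    simp only [Function.comp_apply, LinearMap.pi_apply, T, LinearMap.comp_apply,
      LinearMap.mulRight_apply, hc]
    obtain rfl | hg := eq_or_ne h g
    · obtain rfl | hx := eq_or_ne x y
      · simp [hG]
      · simp [hG, Ne.symm hx]
    · simp [hg, Ne.symm hg]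
  refine injective_of_linearIndependent (π := (π : Crossed D →ₗ[k] L)) (.of_comp (.pi T) ?_)
  change LinearIndependent k (LinearMap.pi T ∘ fun q : Q × H => π (of D q.1 q.2))
  rw [hT]
  exact Pi.linearIndependent_single_of_ne_zero fun q => map_of_ne_zero (h0 q.2) q.1

end

section

variable {L : Type*} [Ring L] [Bialgebra k L] (f : Q → H → L) (h1 : ∑ h, f 1 h = 1)
  (hmul : ∀ x h y g, f x h * f y g = if h = g then D.σ x y h • f (x * y) h else 0)
  (hcounit : ∀ x h, Coalgebra.counit (R := k) (f x h) = if h = 1 then 1 else 0)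
  (hcomul : ∀ x h, Coalgebra.comul (R := k) (f x h) =
    ∑ l : H, f x l⁻¹ ⊗ₜ[k] (D.τ l x (l * h) • f (l • x) (l * h)))

/-- The bialgebra morphism out of `Crossed D` with prescribed values on the basis. -/
def bialgHom : Crossed D →ₐc[k] L where
  __ := lin D f
  counit_comp := hom_ext fun x h => by
    change Coalgebra.counit (lin D f (of D x h)) = Coalgebra.counit (of D x h)
    rw [lin_of, hcounit, counit_of]
  map_comp_comul := hom_ext fun x h => by
    change TensorProduct.map (lin D f) (lin D f) (Coalgebra.comul (of D x h)) =
      Coalgebra.comul (lin D f (of D x h))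
    rw [lin_of, hcomul, comul_of, map_sum]
    simp only [TensorProduct.map_tmul, map_smul, lin_of]
  map_one' := by
    change lin D f 1 = 1
    rw [one_def, map_sum, ← h1]
    simp only [lin_of]
  map_mul' a b := by
    have h2 : (LinearMap.mul k (Crossed D)).compr₂ (lin D f) =
        (LinearMap.mul k L).compl₁₂ (lin D f) (lin D f) := by
      refine hom_ext₂ fun x h y g => ?_
      simp only [LinearMap.compr₂_apply, LinearMap.mul_apply', LinearMap.compl₁₂_apply, lin_of,
        of_mul_of, hmul]
      split_ifs <;> simp
    exact LinearMap.congr_fun (LinearMap.congr_fun h2 a) b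

@[simp] theorem bialgHom_of (x : Q) (h : H) :
    bialgHom f h1 hmul hcounit hcomul (of D x h) = f x h :=
  lin_of _ _ _

end

section

variable {Q' : Type*} [Group Q'] [MulDistribMulAction H Q'] {D' : CocycleDatum k Q' H}
  (f : Q →* Q') (hf : ∀ (l : H) x, f (l • x) = l • f x) (w : Q → H → k)
  (w_one : ∀ h, w 1 h = 1) (w_counit : ∀ x, w x 1 = 1)
  (w_mul : ∀ x y h, w x h * w y h * D'.σ (f x) (f y) h = D.σ x y h * w (x * y) h)
  (w_comul : ∀ l x h, w x h * D'.τ l (f x) (l * h) =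
    D.τ l x (l * h) * w x l⁻¹ * w (l • x) (l * h))

/-- The morphism `x # δ_h ↦ f x # w(x) δ_h` defined by an equivariant group morphism `f` and by
functions `w(x)` on `H` that relate the two data. -/
def map : Crossed D →ₐc[k] Crossed D' :=
  bialgHom (fun x h => w x h • of D' (f x) h)
    (by simp only [w_one, map_one, one_smul, one_def])
    (fun x h y g => by
      rw [smul_mul_smul_comm, of_mul_of]
      by_cases hg : h = g
      · subst hg
        simp only [if_true, smul_smul, w_mul, map_mul]
      · simp [hg])
    (fun x h => by
      rw [map_smul, counit_of]
      by_cases hh : h = 1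
      · subst hh
        simp [w_counit]
      · simp [hh])
    (fun x h => by
      rw [map_smul, comul_of, Finset.smul_sum]
      refine Finset.sum_congr rfl fun l _ => ?_
      simp only [hf, TensorProduct.tmul_smul, ← TensorProduct.smul_tmul', smul_smul]
      congr 1
      rw [w_comul]
      ring)

@[simp] theorem map_of (x : Q) (h : H) :
    map f hf w w_one w_counit w_mul w_comul (of D x h) = w x h • of D' (f x) h :=
  bialgHom_of _ _ _ _ _ _ _

end

end Crossed

section

variable {k V W : Type*} [Field k] [AddCommGroup V] [Module k V] [AddCommGroup W] [Module k W]

theorem tmul_left_cancel {a : V} (ha : a ≠ 0) {b c : W} (h : a ⊗ₜ[k] b = a ⊗ₜ c) : b = c := by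
  obtain ⟨ψ, hψ⟩ := Module.Projective.exists_dual_eq_one k ha
  simpa [hψ] using congrArg (TensorProduct.lid k W ∘ ψ.rTensor W) h

theorem exists_eq_smul_of_tmul_eq_tmul {a b : V} {c d : W} (hc : c ≠ 0)
    (h : a ⊗ₜ[k] c = b ⊗ₜ d) : ∃ t : k, a = t • b := by
  obtain ⟨ψ, hψ⟩ := Module.Projective.exists_dual_eq_one k hc
  exact ⟨ψ d, by simpa [hψ] using congrArg (TensorProduct.rid k V ∘ ψ.lTensor V) h⟩

end

namespace SmashCoproduct

variable {k Γ H : Type*} [Field k] [Group Γ] [Group H] [MulDistribMulAction H Γ]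
  [DecidableEq H] [Fintype H]

section

variable {Γ' : Type*} [Group Γ'] [MulDistribMulAction H Γ']

/-- The morphism of smash coproducts induced by an equivariant group morphism. -/
def map (k : Type*) [Field k] (f : Γ →* Γ') (hf : ∀ (l : H) x, f (l • x) = l • f x) :
    SmashCoproduct k Γ H →ₐc[k] SmashCoproduct k Γ' H :=
  Crossed.map f hf (fun _ _ => 1) (by simp) (by simp) (by simp) (by simp)

@[simp] theorem map_of (f : Γ →* Γ') (hf : ∀ (l : H) x, f (l • x) = l • f x) (x : Γ) (h : H) :
    map k f hf (of k x h) = of k (f x) h := by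
  rw [map, Crossed.map_of, one_smul]

theorem nonempty_bialgEquiv (e : Γ ≃* Γ') (he : ∀ (l : H) x, e (l • x) = l • e x) :
    Nonempty (SmashCoproduct k Γ H ≃ₐc[k] SmashCoproduct k Γ' H) := by
  let f : SmashCoproduct k Γ H →ₐc[k] SmashCoproduct k Γ' H := map k e.toMonoidHom he
  have hf (x : Γ) (h : H) : f (of k x h) = of k (e x) h := map_of _ _ x h
  refine ⟨.ofBijective f ⟨Crossed.injective_of_injective (fun x y hxy => ?_) fun h => ?_,
    Crossed.surjective_of_forall_of_mem_range (f : SmashCoproduct k Γ H →ₗ[k]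
      Crossed (CocycleDatum.trivial k Γ' H)) fun y h => ?_⟩⟩
  · simp only [hf] at hxy
    exact e.injective (Crossed.of_injective 1 hxy)
  · rw [hf]
    exact Crossed.of_ne_zero _ _
  · exact ⟨of k (e.symm y) h, (hf _ _).trans (by rw [e.apply_symm_apply])⟩

end

/-- The morphism `r # δ_h ↦ δ_{h, 1} r` onto the group algebra. -/
def toMonoidAlgebra (k Γ H : Type*) [Field k] [Group Γ] [Group H] [MulDistribMulAction H Γ]
    [DecidableEq H] [Fintype H] : SmashCoproduct k Γ H →ₐc[k] MonoidAlgebra k Γ :=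
  Crossed.bialgHom (fun r h => if h = 1 then .single r 1 else 0)
    (by simp [MonoidAlgebra.one_def])
    (fun x h y g => by
      obtain rfl | hg := eq_or_ne h g
      · by_cases h1 : h = 1 <;> simp [h1, MonoidAlgebra.single_mul_single]
      · obtain rfl | h1 := eq_or_ne h 1
        · simp [hg, hg.symm]
        · simp [hg, h1])
    (fun x h => by split_ifs <;> simp)
    (fun x h => by
      rw [Finset.sum_eq_single 1]
      · by_cases h1 : h = 1 <;> simp [h1]
      · intro l _ hl
        simp [hl]
      · simp)

@[simp] theorem toMonoidAlgebra_of (x : Γ) (h : H) :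
    toMonoidAlgebra k Γ H (of k x h) = if h = 1 then .single x 1 else 0 :=
  Crossed.bialgHom_of _ _ _ _ _ _ _

theorem toMonoidAlgebra_surjective : Function.Surjective (toMonoidAlgebra k Γ H) := by
  intro y
  induction y using MonoidAlgebra.induction_linear with
  | zero => exact ⟨0, map_zero _⟩
  | add a b ha hb =>
    obtain ⟨a, rfl⟩ := ha
    obtain ⟨b, rfl⟩ := hb
    exact ⟨a + b, map_add _ _ _⟩
  | single g c =>
    refine ⟨c • of k g 1, ?_⟩
    rw [map_smul, toMonoidAlgebra_of, if_pos rfl, MonoidAlgebra.smul_single, smul_eq_mul, mul_one]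

end SmashCoproduct

namespace QuotientDatum

variable {k Γ H : Type*} [Field k] [Group Γ] [Group H] [MulDistribMulAction H Γ]
  (E : QuotientDatum k Γ H)

theorem mul_j_inv_mem (r : Γ) : r * (E.j r)⁻¹ ∈ E.N := E.mem_of_mk (by simp)

theorem cocycleDatum_eq_trivial (hΦ : E.Φ = 1) :
    E.cocycleDatum = CocycleDatum.trivial k (Γ ⧸ E.N) H := by
  have h (r : Γ) (hr : r ∈ E.N) (h : H) : E.val r hr h = 1 := by simp [val, hΦ]
  simp only [cocycleDatum, h]
  rfl

/-- The quotient datum with trivial `Φ`. -/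
def ofSubgroup (k : Type*) [Field k] (N : Subgroup Γ) [N.Normal]
    (hN : ∀ (h : H), ∀ r ∈ N, h • r ∈ N) : QuotientDatum k Γ H where
  N := N
  normal := ‹_›
  stable := hN
  Φ := 1
  Φ_mul _ _ _ := (mul_one _).symm
  Φ_conj _ _ := rfl

variable [DecidableEq H] [Fintype H]

theorem nonempty_bialgEquiv_smashCoproduct (hΦ : E.Φ = 1) :
    Nonempty (E.Twisted ≃ₐc[k] SmashCoproduct k (Γ ⧸ E.N) H) := by
  unfold Twisted
  rw [E.cocycleDatum_eq_trivial hΦ]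
  exact ⟨.refl k _⟩

/-- The projection `r # δ_h ↦ [r] # Φ(r j([r])⁻¹) δ_h`. -/
def proj : SmashCoproduct k Γ H →ₐc[k] E.Twisted :=
  Crossed.map (QuotientGroup.mk' E.N) (fun _ _ => rfl)
    (fun r h => E.val (r * (E.j r)⁻¹) (E.mul_j_inv_mem r) h)
    (fun h => E.val_one (by rw [QuotientGroup.mk_one, j_one, inv_one, one_mul]) _ _)
    (fun x => E.val_at_one _ _)
    (fun x y h => by
      change E.val (x * (E.j x)⁻¹) (E.mul_j_inv_mem x) h *
        E.val (y * (E.j y)⁻¹) (E.mul_j_inv_mem y) h *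
        E.val (E.j x * E.j y * (E.j ((x : Γ ⧸ E.N) * y))⁻¹) (E.σ_mem x y) h =
        1 * E.val (x * y * (E.j ((x : Γ ⧸ E.N) * y))⁻¹) (E.mul_j_inv_mem (x * y)) h
      have hc := E.normal.conj_mem _ (E.mul_j_inv_mem y) (E.j x)
      rw [← E.val_conj (E.j x) _ (E.mul_j_inv_mem y) hc,
        ← E.val_mul _ _ _ _ (E.N.mul_mem (E.mul_j_inv_mem x) hc),
        ← E.val_mul _ _ _ _ (E.N.mul_mem (E.N.mul_mem (E.mul_j_inv_mem x) hc) (E.σ_mem _ _)),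
        one_mul]
      refine E.val_congr ?_ _ _ _
      group)
    (fun l x h => by
      change E.val (x * (E.j x)⁻¹) (E.mul_j_inv_mem x) h *
        E.val (l • E.j x * (E.j (l • (x : Γ ⧸ E.N)))⁻¹) (E.τ_mem l x) (l * h) =
        1 * E.val (x * (E.j x)⁻¹) (E.mul_j_inv_mem x) l⁻¹ *
          E.val (l • x * (E.j (l • (x : Γ ⧸ E.N)))⁻¹) (E.mul_j_inv_mem (l • x)) (l * h)
      have hl := E.stable l _ (E.mul_j_inv_mem x)
      rw [E.val_cocycle _ (E.mul_j_inv_mem x) l h hl, one_mul, mul_right_comm,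
        ← E.val_mul _ _ _ _ (E.N.mul_mem hl (E.τ_mem _ _)), mul_comm]
      congr 1
      refine E.val_congr ?_ _ _ _
      rw [smul_mul', smul_inv']
      group)

theorem proj_of (r : Γ) (h : H) : E.proj (SmashCoproduct.of k r h) =
    E.val (r * (E.j r)⁻¹) (E.mul_j_inv_mem r) h • Crossed.of E.cocycleDatum r h :=
  Crossed.map_of _ _ _ _ _ _ _ _ _

theorem proj_surjective : Function.Surjective E.proj := by
  refine Crossed.surjective_of_forall_of_mem_range
    (E.proj : SmashCoproduct k Γ H →ₗ[k] Crossed E.cocycleDatum) fun y h => ?_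
  refine ⟨SmashCoproduct.of k (E.j y) h, (E.proj_of _ _).trans ?_⟩
  rw [E.val_one (by rw [mk_j, mul_inv_cancel]), one_smul, mk_j]

end QuotientDatum

namespace SmashCoproduct

variable {k Γ H L : Type*} [Field k] [Group Γ] [Group H] [MulDistribMulAction H Γ]
  [DecidableEq H] [Fintype H] [Ring L] [Bialgebra k L] {π : SmashCoproduct k Γ H →ₐc[k] L}

variable (π) in
theorem map_of_mul (r s : Γ) (h : H) :
    π (of k (r * s) h) = π (of k r h) * π (of k s h) := by
  rw [← map_mul, of_mul_of, if_pos rfl]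

variable (π) in
/-- The elements `r` with `π (r # δ_1) = π (1 # δ_1)`. -/
def kernel : Subgroup Γ where
  carrier := {r | π (of k r 1) = π (of k 1 1)}
  one_mem' := rfl
  mul_mem' {r s} (hr : π (of k r 1) = _) (hs : π (of k s 1) = _) := by
    rw [Set.mem_ofPred_eq, map_of_mul, hr, hs, ← map_of_mul, one_mul]
  inv_mem' {r} (hr : π (of k r 1) = _) := by
    rw [Set.mem_ofPred_eq, ← mul_one r⁻¹, map_of_mul, ← hr, ← map_of_mul, inv_mul_cancel, hr]

theorem mem_kernel {r : Γ} : r ∈ kernel π ↔ π (of k r 1) = π (of k 1 1) := Iff.rfl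

theorem mul_inv_mem_kernel {r s : Γ} (h : π (of k r 1) = π (of k s 1)) : r * s⁻¹ ∈ kernel π := by
  rw [mem_kernel, map_of_mul, h, ← map_of_mul, mul_inv_cancel]

theorem kernel_normal : (kernel π).Normal where
  conj_mem r hr s := by
    rw [mem_kernel] at hr ⊢
    rw [map_of_mul, map_of_mul, hr, ← map_of_mul, ← map_of_mul, mul_one, mul_inv_cancel]

theorem map_of_tmul_map_of {r : Γ} {h : H} {c : k} (hc : π (of k r h) = c • π (of k 1 h))
    (l : H) : π (of k r l⁻¹) ⊗ₜ[k] π (of k (l • r) (l * h)) =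
      c • (π (of k 1 l⁻¹) ⊗ₜ π (of k 1 (l * h))) := by
  have hr := Crossed.comul_map_of_mul π r h l (l * h)
  have h1 := Crossed.comul_map_of_mul π 1 h l (l * h)
  simp only [if_true, CocycleDatum.trivial_τ, one_smul, smul_one] at hr h1
  rw [← hr, hc, map_smul, smul_mul_assoc, h1]

variable (h0 : ∀ h, π (of k 1 h) ≠ 0)
include h0

theorem exists_map_of_eq_smul {r : Γ} (hr : r ∈ kernel π) (h : H) :
    ∃ c : k, π (of k r h) = c • π (of k 1 h) := by
  have hc : π (of k r 1) = (1 : k) • π (of k 1 1) := by rw [mem_kernel.1 hr, one_smul]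
  have h1 := map_of_tmul_map_of hc h⁻¹
  rw [one_smul, inv_inv] at h1
  exact exists_eq_smul_of_tmul_eq_tmul (Crossed.map_of_ne_zero (h0 _) _) h1

theorem smul_mem_kernel (l : H) {r : Γ} (hr : r ∈ kernel π) : l • r ∈ kernel π := by
  obtain ⟨c, hc⟩ := exists_map_of_eq_smul h0 hr l⁻¹
  have h1 := map_of_tmul_map_of hc l
  rw [mul_inv_cancel, TensorProduct.smul_tmul', ← hc] at h1
  exact tmul_left_cancel (Crossed.map_of_ne_zero (h0 _) _) h1

/-- The scalars with `π (r # δ_h) = Φ(r)(h) π (1 # δ_h)`, for `r` in `kernel π`. -/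
def weight (r : kernel π) (h : H) : k := (exists_map_of_eq_smul h0 r.2 h).choose

theorem map_of_eq_weight_smul (r : kernel π) (h : H) :
    π (of k r h) = weight h0 r h • π (of k 1 h) :=
  (exists_map_of_eq_smul h0 r.2 h).choose_spec

theorem weight_eq {r : kernel π} {h : H} {c : k} (hc : π (of k r h) = c • π (of k 1 h)) :
    weight h0 r h = c :=
  smul_left_injective k (h0 h) ((map_of_eq_weight_smul h0 r h).symm.trans hc)

theorem weight_mul (r s : kernel π) : weight h0 (r * s) = weight h0 r * weight h0 s :=
  funext fun h => weight_eq h0 <| by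
    rw [Subgroup.coe_mul, map_of_mul, map_of_eq_weight_smul h0 r, map_of_eq_weight_smul h0 s,
      smul_mul_smul_comm, ← map_of_mul, one_mul, Pi.mul_apply]

theorem weight_conj (r : kernel π) (s : Γ) :
    weight h0 ⟨s * r * s⁻¹, (kernel_normal (π := π)).conj_mem r r.2 s⟩ = weight h0 r :=
  funext fun h => weight_eq h0 <| by
    rw [map_of_mul, map_of_mul, map_of_eq_weight_smul h0 r, mul_smul_comm, smul_mul_assoc,
      ← map_of_mul, ← map_of_mul, mul_one, mul_inv_cancel]

theorem weight_apply_mul (r : kernel π) (l h : H) : weight h0 r (l * h) =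
    weight h0 ⟨l⁻¹ • r, smul_mem_kernel h0 l⁻¹ r.2⟩ h * weight h0 r l := by
  have h1 := map_of_tmul_map_of (map_of_eq_weight_smul h0 r (l * h)) l⁻¹
  rw [inv_inv, inv_mul_cancel_left, map_of_eq_weight_smul h0 r l,
    map_of_eq_weight_smul h0 ⟨l⁻¹ • r, smul_mem_kernel h0 l⁻¹ r.2⟩ h,
    TensorProduct.smul_tmul, ← TensorProduct.tmul_smul, smul_smul] at h1
  rw [mul_comm]
  exact (smul_left_injective k (h0 h) (tmul_left_cancel (h0 l) h1)).symm

/-- The quotient datum attached to `π`, when `π` does not kill any `1 # δ_h`. -/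
def quotientDatum : QuotientDatum k Γ H where
  N := kernel π
  normal := kernel_normal
  stable l _ hr := smul_mem_kernel h0 l hr
  Φ := MonoidHom.toHomUnits
    { toFun := weight h0
      map_one' := funext fun _ => weight_eq h0 (one_smul k _).symm
      map_mul' := weight_mul h0 }
  Φ_mul := weight_apply_mul h0
  Φ_conj r s := Units.ext (weight_conj h0 r s)

theorem map_of_eq_val_smul {r s : Γ} (hrs : r * s⁻¹ ∈ (quotientDatum h0).N) (h : H) :
    π (of k r h) = (quotientDatum h0).val (r * s⁻¹) hrs h • π (of k s h) := by
  have h1 : π (of k (r * s⁻¹) h) = (quotientDatum h0).val (r * s⁻¹) hrs h • π (of k 1 h) :=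
    map_of_eq_weight_smul h0 ⟨r * s⁻¹, hrs⟩ h
  calc π (of k r h) = π (of k (r * s⁻¹) h) * π (of k s h) := by
        rw [← map_of_mul, inv_mul_cancel_right]
    _ = _ := by rw [h1, smul_mul_assoc, ← map_of_mul, one_mul]

/-- The morphism `x # δ_h ↦ π (j x # δ_h)` through which `π` factors. -/
def fromTwisted : (quotientDatum h0).Twisted →ₐc[k] L :=
  Crossed.bialgHom (fun x h => π (of k ((quotientDatum h0).j x) h))
    (by
      rw [QuotientDatum.j_one, ← map_sum, ← map_one π]
      rfl)
    (fun x h y g => by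
      rw [← map_mul, of_mul_of]
      split_ifs
      · exact map_of_eq_val_smul h0 ((quotientDatum h0).σ_mem x y) h
      · exact map_zero π)
    (fun x h => Crossed.counit_map_of π _ h)
    (fun x h => by
      rw [← CoalgHomClass.map_comp_comul_apply π]
      refine (congrArg _ (comul_of _ h)).trans ((map_sum _ _ _).trans ?_)
      exact Finset.sum_congr rfl fun l _ => congrArg (π (of k _ l⁻¹) ⊗ₜ ·) <|
        map_of_eq_val_smul h0 ((quotientDatum h0).τ_mem l x) (l * h))

@[simp] theorem fromTwisted_of (x : Γ ⧸ (quotientDatum h0).N) (h : H) :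
    fromTwisted h0 (Crossed.of _ x h) = π (of k ((quotientDatum h0).j x) h) :=
  Crossed.bialgHom_of _ _ _ _ _ _ _

theorem injective_of_kernel_eq_bot (hN : kernel π = ⊥) : Function.Injective π :=
  Crossed.injective_of_injective (fun _ _ hrs => mul_inv_eq_one.1 <| Subgroup.mem_bot.1 <|
    hN ▸ mul_inv_mem_kernel hrs) h0

theorem fromTwisted_injective : Function.Injective (fromTwisted h0) := by
  refine Crossed.injective_of_injective (fun x y hxy => ?_) fun h => ?_
  · simp only [fromTwisted_of] at hxy
    have hmk := (QuotientGroup.eq_one_iff (N := (quotientDatum h0).N) _).2 (mul_inv_mem_kernel hxy)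
    simpa [mul_inv_eq_one] using hmk
  · rw [fromTwisted_of, QuotientDatum.j_one]
    exact h0 h

theorem fromTwisted_surjective (hπ : Function.Surjective π) :
    Function.Surjective (fromTwisted h0) := by
  let P : SmashCoproduct k Γ H →ₗ[k] L := π
  let F : (quotientDatum h0).Twisted →ₗ[k] L := fromTwisted h0
  change Function.Surjective F
  rw [← LinearMap.range_eq_top, eq_top_iff, ← Crossed.span_map_of (π := P) hπ, Submodule.span_le]
  rintro _ ⟨⟨r, h⟩, rfl⟩
  have hr : r * ((quotientDatum h0).j r)⁻¹ ∈ (quotientDatum h0).N :=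
    (quotientDatum h0).mul_j_inv_mem r
  change π (of k r h) ∈ LinearMap.range F
  rw [map_of_eq_val_smul h0 hr]
  exact Submodule.smul_mem _ _ ⟨_, fromTwisted_of h0 _ _⟩

theorem nonempty_bialgEquiv_twisted (hπ : Function.Surjective π) :
    Nonempty (L ≃ₐc[k] (quotientDatum h0).Twisted) :=
  ⟨(BialgEquiv.ofBijective (fromTwisted h0)
    ⟨fromTwisted_injective h0, fromTwisted_surjective h0 hπ⟩).symm⟩

end SmashCoproduct

theorem zpowersHom_ext {Γ M : Type*} [Group Γ] [Group M] {z : Γ} {f g : Subgroup.zpowers z →* M}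
    (h : f ⟨z, Subgroup.mem_zpowers z⟩ = g ⟨z, Subgroup.mem_zpowers z⟩) : f = g := by
  ext ⟨_, n, rfl⟩
  change f (⟨z, Subgroup.mem_zpowers z⟩ ^ n) = g (⟨z, Subgroup.mem_zpowers z⟩ ^ n)
  rw [map_zpow, map_zpow, h]

namespace C₂

theorem eq_one_or_gen (t : C₂) : t = 1 ∨ t = gen := by
  revert t
  decide

theorem gen_ne_one : gen ≠ 1 := by decide

theorem sum_eq {V : Type*} [AddCommMonoid V] (f : C₂ → V) : ∑ t, f t = f 1 + f gen := by
  rw [show (Finset.univ : Finset C₂) = {1, gen} by decide, Finset.sum_pair (by decide)]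

@[simp] theorem lift_gen {G : Type*} [Group G] (g : G) (hg : g * g = 1) : lift g hg gen = g := by
  rw [lift, MonoidHom.coe_mk, OneHom.coe_mk, if_neg gen_ne_one]

end C₂

namespace DInf

theorem g₀_mul_rot_zpow (n : ℤ) : g₀ * rot ^ n = rot ^ (-n) * g₀ := by
  rw [← mul_inv_eq_iff_eq_mul, ← conj_zpow, g₀_conj_rot, inv_zpow, zpow_neg]

theorem g₁_eq : g₁ = rot⁻¹ * g₀ := by
  rw [rot, mul_inv_rev, g₀_inv, g₁_inv, mul_assoc, g₀_mul_self, mul_one]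

theorem eq_rot_zpow_or (x : DInf) : ∃ n : ℤ, x = rot ^ n ∨ x = rot ^ n * g₀ := by
  have h0 : ∀ x : DInf, (∃ n : ℤ, x = rot ^ n ∨ x = rot ^ n * g₀) →
      ∃ n : ℤ, g₀ * x = rot ^ n ∨ g₀ * x = rot ^ n * g₀ := by
    rintro _ ⟨n, rfl | rfl⟩
    · exact ⟨-n, .inr (g₀_mul_rot_zpow n)⟩
    · exact ⟨-n, .inl (by rw [← mul_assoc, g₀_mul_rot_zpow, mul_assoc, g₀_mul_self, mul_one])⟩
  induction x using DInf.induction with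
  | h1 => exact ⟨0, .inl (zpow_zero _).symm⟩
  | h₀ x hx => exact h0 x hx
  | h₁ x hx =>
    rw [g₁_eq, mul_assoc]
    obtain ⟨n, h | h⟩ := h0 x hx <;> rw [h]
    · exact ⟨-1 + n, .inl (by rw [zpow_add, zpow_neg_one])⟩
    · exact ⟨-1 + n, .inr (by rw [zpow_add, zpow_neg_one, mul_assoc])⟩

theorem gen_smul_rot : C₂.gen • rot = rot⁻¹ := by
  rw [rot, smul_mul', gen_smul_g₀, gen_smul_g₁, mul_inv_rev, g₀_inv, g₁_inv]

theorem toDihedral_g₀ (n : ℕ) : toDihedral n g₀ = .sr 0 := by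
  rw [toDihedral, g₀, Monoid.Coprod.lift_apply_inl, C₂.lift_gen]

theorem toDihedral_g₁ (n : ℕ) : toDihedral n g₁ = .sr 1 := by
  rw [toDihedral, g₁, Monoid.Coprod.lift_apply_inr, C₂.lift_gen]

theorem toDihedral_rot_zpow (n : ℕ) (i : ℤ) : toDihedral n (rot ^ i) = .r i := by
  rw [map_zpow, toDihedral_rot, DihedralGroup.r_one_zpow]

theorem toDihedral_rot_zpow_mul_g₀ (n : ℕ) (i : ℤ) : toDihedral n (rot ^ i * g₀) = .sr (-i) := by
  rw [map_mul, toDihedral_rot_zpow, toDihedral_g₀, DihedralGroup.r_mul_sr, zero_sub]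

theorem toDihedral_surjective (n : ℕ) : Function.Surjective (toDihedral n) := by
  rintro (i | i)
  · obtain ⟨a, rfl⟩ := ZMod.intCast_surjective i
    exact ⟨_, toDihedral_rot_zpow n a⟩
  · obtain ⟨a, rfl⟩ := ZMod.intCast_surjective i
    exact ⟨rot ^ (-a) * g₀, by rw [toDihedral_rot_zpow_mul_g₀, Int.cast_neg, neg_neg]⟩

theorem toDihedral_smul (n : ℕ) (t : C₂) (x : DInf) :
    toDihedral n (t • x) = t • toDihedral n x := by
  rcases C₂.eq_one_or_gen t with rfl | rfl
  · rw [one_smul, one_smul]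
  · have h0 : C₂.gen • (DihedralGroup.sr 0 : DihedralGroup n) = .sr 1 :=
      congrArg DihedralGroup.sr (sub_zero 1)
    have h1 : C₂.gen • (DihedralGroup.sr 1 : DihedralGroup n) = .sr 0 :=
      congrArg DihedralGroup.sr (sub_self 1)
    induction x using DInf.induction with
    | h1 => rw [smul_one, map_one, smul_one]
    | h₀ x hx => rw [smul_mul', map_mul, map_mul, smul_mul', hx, gen_smul_g₀, toDihedral_g₀,
        toDihedral_g₁, h0]
    | h₁ x hx => rw [smul_mul', map_mul, map_mul, smul_mul', hx, gen_smul_g₁, toDihedral_g₀,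
        toDihedral_g₁, h1]

section

variable {G : Type*} [Group G] {f : DInf →* G}

theorem ker_eq_zpowers (hf : ∀ i : ℤ, f (rot ^ i * g₀) ≠ 1) :
    f.ker = Subgroup.zpowers (rot ^ orderOf (f rot)) := by
  ext x
  rw [MonoidHom.mem_ker]
  constructor
  · intro hx
    obtain ⟨n, rfl | rfl⟩ := eq_rot_zpow_or x
    · rw [map_zpow, ← orderOf_dvd_iff_zpow_eq_one] at hx
      obtain ⟨c, rfl⟩ := hx
      exact ⟨c, by simp only [zpow_mul, zpow_natCast]⟩
    · exact absurd hx (hf n)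
  · rintro ⟨c, rfl⟩
    simp [pow_orderOf_eq_one]

theorem ker_eq_bot_or_N (hf : ∀ i : ℤ, f (rot ^ i * g₀) ≠ 1) :
    f.ker = ⊥ ∨ ∃ m, f.ker = N m := by
  rw [ker_eq_zpowers hf]
  obtain h0 | h0 := Nat.eq_zero_or_pos (orderOf (f rot))
  · left
    rw [h0, pow_zero, Subgroup.zpowers_one_eq_bot]
  · exact .inr ⟨⟨_, h0⟩, rfl⟩

theorem map_g₀_of_map_eq_one {i : ℤ} (hi : f (rot ^ i * g₀) = 1) : f g₀ = f rot ^ (-i) := by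
  rw [map_mul, map_zpow, mul_eq_one_iff_eq_inv'] at hi
  rw [hi, zpow_neg]

theorem map_rot_sq_of_map_eq_one {i : ℤ} (hi : f (rot ^ i * g₀) = 1) : f rot ^ 2 = 1 := by
  have h : f rot = (f rot)⁻¹ := by
    rw [← map_inv, ← g₀_conj_rot, map_mul, map_mul, map_inv, map_g₀_of_map_eq_one hi]
    group
  rw [pow_two, mul_eq_one_iff_eq_inv, ← h]

theorem subsingleton_or_mulEquiv_of_map_eq_one (hf : Function.Surjective f) {i : ℤ}
    (hi : f (rot ^ i * g₀) = 1) : Subsingleton G ∨ Nonempty (G ≃* DihedralGroup 1) := by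
  have hmem (y : G) : y ∈ Subgroup.zpowers (f rot) := by
    obtain ⟨x, rfl⟩ := hf y
    obtain ⟨n, rfl | rfl⟩ := eq_rot_zpow_or x
    · exact ⟨n, (map_zpow f _ _).symm⟩
    · exact ⟨n + -i, by rw [map_mul, map_zpow, map_g₀_of_map_eq_one hi, ← zpow_add]⟩
  have hcard := orderOf_eq_card_of_forall_mem_zpowers hmem
  obtain h | h := (Nat.dvd_prime Nat.prime_two).1
    (orderOf_dvd_of_pow_eq_one (map_rot_sq_of_map_eq_one hi))
  · exact .inl (Nat.card_eq_one_iff_unique.1 (hcard ▸ h)).1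
  · have : Fact (Nat.Prime 2) := ⟨Nat.prime_two⟩
    exact .inr ⟨mulEquivOfPrimeCardEq (hcard ▸ h) DihedralGroup.nat_card⟩

end

theorem ker_toDihedral (m : ℕ+) : (toDihedral m).ker = N m := by
  rw [ker_eq_zpowers, toDihedral_rot, DihedralGroup.orderOf_r_one]
  · rfl
  · intro i hi
    rw [toDihedral_rot_zpow_mul_g₀, DihedralGroup.one_def] at hi
    cases hi

/-- The isomorphism between `D_∞ / N_m` and the dihedral group of order `2 m`. -/
def quotientEquiv (m : ℕ+) : DInf ⧸ N m ≃* DihedralGroup m :=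
  (QuotientGroup.quotientMulEquivOfEq (ker_toDihedral m).symm).trans
    (QuotientGroup.quotientKerEquivOfSurjective _ (toDihedral_surjective m))

theorem quotientEquiv_smul (m : ℕ+) (t : C₂) (x : DInf ⧸ N m) :
    quotientEquiv m (t • x) = t • quotientEquiv m x := by
  induction x using QuotientGroup.induction_on with
  | H r => exact toDihedral_smul m t r

instance (m : ℕ+) : Finite (DInf ⧸ N m) := by
  have : NeZero (m : ℕ) := ⟨m.ne_zero⟩
  exact Finite.of_equiv _ (quotientEquiv m).toEquiv.symm

instance : Infinite DInf := .of_injective _ rot_zpow_injective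

theorem quotient_cases {G : Type*} [Group G] {f : DInf →* G} (hf : Function.Surjective f) :
    Subsingleton G ∨ Nonempty (DInf ≃* G) ∨ ∃ m : ℕ+, Nonempty (G ≃* DihedralGroup m) := by
  by_cases hr : ∃ i : ℤ, f (rot ^ i * g₀) = 1
  · obtain ⟨i, hi⟩ := hr
    exact (subsingleton_or_mulEquiv_of_map_eq_one hf hi).imp_right fun h => .inr ⟨1, h⟩
  · obtain h | ⟨m, h⟩ := ker_eq_bot_or_N (not_exists.1 hr)
    · exact .inr (.inl ⟨.ofBijective f ⟨(MonoidHom.ker_eq_bot_iff f).1 h, hf⟩⟩)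
    · exact .inr (.inr ⟨m, ⟨(QuotientGroup.quotientKerEquivOfSurjective f hf).symm.trans
        ((QuotientGroup.quotientMulEquivOfEq h).trans (quotientEquiv m))⟩⟩)

/-- Exchanging the generators maps the reflection `rot ^ i * g₀` to `rot ^ (-i - 1) * g₀`, and the
product of the two is an odd power of `rot`. -/
theorem eq_top_of_rot_zpow_mul_g₀_mem {M : Subgroup DInf} [M.Normal]
    (hM : ∀ r ∈ M, C₂.gen • r ∈ M) {i : ℤ} (hi : rot ^ i * g₀ ∈ M) : M = ⊤ := by
  have hker (x : DInf) : x ∈ M ↔ (QuotientGroup.mk' M) x = 1 := (QuotientGroup.eq_one_iff x).symm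
  have hsq := map_rot_sq_of_map_eq_one ((hker _).1 hi)
  have h0 := map_g₀_of_map_eq_one ((hker _).1 hi)
  have hgen : C₂.gen • (rot ^ i * g₀) = rot ^ (-i - 1) * g₀ := by
    rw [smul_mul', smul_zpow', gen_smul_rot, gen_smul_g₀, g₁_eq, ← mul_assoc, inv_zpow',
      zpow_sub_one]
  have h1 := map_g₀_of_map_eq_one ((hker _).1 (hgen ▸ hM _ hi))
  have hrot : QuotientGroup.mk' M rot = 1 := by
    have h2 : QuotientGroup.mk' M rot ^ (2 * i + 1) = 1 := by
      rw [show 2 * i + 1 = -(-i - 1) - -i by ring, zpow_sub, ← h1, ← h0, mul_inv_cancel]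
    rwa [zpow_add_one, zpow_mul, zpow_ofNat, hsq, one_zpow, one_mul] at h2
  refine top_unique fun x _ => (hker x).2 ?_
  obtain ⟨n, rfl | rfl⟩ := eq_rot_zpow_or x
  · rw [map_zpow, hrot, one_zpow]
  · rw [map_mul, map_zpow, h0, hrot, one_zpow, one_zpow, one_mul]

theorem eq_bot_or_top_or_N {M : Subgroup DInf} [M.Normal] (hM : ∀ r ∈ M, C₂.gen • r ∈ M) :
    M = ⊥ ∨ M = ⊤ ∨ ∃ m, M = N m := by
  by_cases hr : ∃ i : ℤ, rot ^ i * g₀ ∈ M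
  · obtain ⟨i, hi⟩ := hr
    exact .inr (.inl (eq_top_of_rot_zpow_mul_g₀_mem hM hi))
  · have hker := ker_eq_bot_or_N (f := QuotientGroup.mk' M) fun i h =>
      hr ⟨i, (QuotientGroup.eq_one_iff _).1 h⟩
    rw [QuotientGroup.ker_mk'] at hker
    exact hker.imp_right .inr

variable {k : Type*} [Field k]

/-- Conjugation by `g₀` inverts the elements of `N_m`, so that `Φ` takes the values `±1`. -/
theorem val_mul_self (E : QuotientDatum k DInf C₂) {z : DInf} (hz : z ∈ E.N)
    (hconj : g₀ * z * g₀⁻¹ = z⁻¹) (t : C₂) : E.val z hz t * E.val z hz t = 1 := by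
  have hinv := E.N.inv_mem hz
  calc E.val z hz t * E.val z hz t = E.val z hz t * E.val z⁻¹ hinv t := by
        rw [← E.val_conj g₀ z hz (hconj ▸ hinv) t, E.val_congr hconj _ hinv]
    _ = 1 := by
      rw [← E.val_mul z z⁻¹ hz hinv (E.N.mul_mem hz hinv), E.val_one (mul_inv_cancel z)]

theorem χ_one : (χ k : C₂ → k) 1 = 1 := by rw [χ, Units.val_mk, if_pos rfl]

theorem χ_gen : (χ k : C₂ → k) C₂.gen = -1 := by rw [χ, Units.val_mk, if_neg C₂.gen_ne_one]

theorem g₀_conj_rot_pow (m : ℕ) : g₀ * rot ^ m * g₀⁻¹ = (rot ^ m)⁻¹ := by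
  rw [← conj_pow, g₀_conj_rot, inv_pow]

theorem quotientDatum_eq {E : QuotientDatum k DInf C₂} {m : ℕ+} (hE : E.N = N m) :
    E = .ofSubgroup k (N m) (N_stable m) ∨ E = datum k m := by
  have hz : rot ^ (m : ℕ) ∈ E.N := hE ▸ Subgroup.mem_zpowers _
  have h1 := E.val_at_one _ hz
  have hg := mul_self_eq_one_iff.1 (val_mul_self E hz (g₀_conj_rot_pow m) C₂.gen)
  obtain ⟨M, hM, hs, Φ', hmul, hconj⟩ := E
  obtain rfl : M = N m := hE
  have hΦ {u : (C₂ → k)ˣ} (hu1 : (u : C₂ → k) 1 = 1)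
      (hu : (Φ' ⟨rot ^ (m : ℕ), hz⟩ : C₂ → k) C₂.gen = (u : C₂ → k) C₂.gen) :
      Φ' ⟨rot ^ (m : ℕ), hz⟩ = u := by
    ext t
    obtain rfl | rfl := C₂.eq_one_or_gen t
    exacts [h1.trans hu1.symm, hu]
  have hχ : Φ' = 1 ∨ Φ' = DInf.Φ k m := hg.imp
    (fun h => zpowersHom_ext (hΦ rfl h))
    (fun h => zpowersHom_ext ((hΦ χ_one (h.trans χ_gen.symm)).trans (Φ_gen k m).symm))
  obtain rfl | rfl := hχ
  exacts [.inl rfl, .inr rfl]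

theorem quotientDatum_cases (E : QuotientDatum k DInf C₂) :
    E.N = ⊥ ∨ E.N = ⊤ ∨ ∃ m, E = .ofSubgroup k (N m) (N_stable m) ∨ E = datum k m := by
  have := E.normal
  exact (eq_bot_or_top_or_N fun r hr => E.stable C₂.gen r hr).imp_right <| Or.imp_right
    fun ⟨m, hm⟩ => ⟨m, quotientDatum_eq hm⟩

end DInf

namespace SmashCoproduct

variable {k Γ H L : Type*} [Field k] [Group Γ] [Group H] [MulDistribMulAction H Γ]
  [DecidableEq H] [Fintype H] [Ring L] [Bialgebra k L] {π : SmashCoproduct k Γ H →ₐc[k] L}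
  (h0 : ∀ h ≠ 1, π (of k 1 h) = 0)
include h0

theorem map_of_eq_zero (r : Γ) {h : H} (hh : h ≠ 1) : π (of k r h) = 0 := by
  rw [← mul_one r, map_of_mul, h0 h hh, mul_zero]

/-- The morphism `r ↦ π (r # δ_1)`, when `π` kills `1 # δ_h` for all `h ≠ 1`. -/
def groupHom : Γ →* L where
  toFun r := π (of k r 1)
  map_one' := by
    rw [← map_one π, Crossed.one_def, map_sum]
    exact (Finset.sum_eq_single 1 (fun h _ hh => h0 h hh) (by simp)).symm
  map_mul' r s := map_of_mul π r s 1

theorem isGroupLikeElem_groupHom (r : Γ) : IsGroupLikeElem k (groupHom h0 r) where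
  counit_eq_one := (Crossed.counit_map_of π r 1).trans (if_pos rfl)
  comul_eq_tmul_self := by
    change Coalgebra.comul (R := k) (π (of k r 1)) = π (of k r 1) ⊗ₜ π (of k r 1)
    rw [← CoalgHomClass.map_comp_comul_apply π, comul_of, map_sum, Finset.sum_eq_single 1]
    · simp
    · intro l _ hl
      rw [TensorProduct.map_tmul]
      exact (congrArg (· ⊗ₜ _) (map_of_eq_zero h0 r (inv_ne_one.2 hl))).trans
        (TensorProduct.zero_tmul _ _)
    · simp

theorem span_groupHom (hπ : Function.Surjective π) :
    Submodule.span k (Set.range (groupHom h0)) = ⊤ := by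
  rw [eq_top_iff, ← Crossed.span_map_of (π := (π : SmashCoproduct k Γ H →ₗ[k] L)) hπ,
    Submodule.span_le, Set.range_subset_iff]
  intro ⟨r, h⟩
  obtain rfl | hh := eq_or_ne h 1
  · exact Submodule.subset_span ⟨r, rfl⟩
  · change π (of k r h) ∈ _
    rw [map_of_eq_zero h0 r hh]
    exact zero_mem _

end SmashCoproduct

namespace Crossed

variable {k Q H : Type*} [Field k] [Group Q] [Group H] [MulDistribMulAction H Q]
  [DecidableEq H] [Fintype H] (D : CocycleDatum k Q H)

/-- A character of `H`, as the element `1 # χ` of the crossed coproduct. -/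
def character : (H →* kˣ) →* Crossed D where
  toFun χ := ∑ h, (χ h : k) • of D 1 h
  map_one' := by simp [one_def]
  map_mul' χ ψ := by
    simp [Finset.sum_mul_sum, of_mul_of_one, smul_smul, mul_comm]

theorem character_apply (χ : H →* kˣ) : character D χ = ∑ h, (χ h : k) • of D 1 h := rfl

theorem isGroupLikeElem_character (χ : H →* kˣ) : IsGroupLikeElem k (character D χ) where
  counit_eq_one := by simp [character_apply, counit_of]
  comul_eq_tmul_self := by
    calc
      Coalgebra.comul (character D χ)
          = ∑ l, ∑ h, (χ h : k) • of D 1 l⁻¹ ⊗ₜ[k] of D 1 (l * h) := by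
        simp only [character_apply, map_sum, map_smul, comul_of, smul_one, D.τ_one_elt, one_smul,
          Finset.smul_sum]
        exact Finset.sum_comm
      _ = ∑ a, ∑ b, (χ (a * b) : k) • of D 1 a ⊗ₜ[k] of D 1 b :=
        Fintype.sum_equiv (Equiv.inv H) _ _ fun l =>
          Fintype.sum_equiv (Equiv.mulLeft l) _ _ fun h => by simp
      _ = character D χ ⊗ₜ character D χ := by
        rw [character_apply, TensorProduct.sum_tmul]
        simp only [TensorProduct.tmul_sum, TensorProduct.smul_tmul_smul, map_mul, Units.val_mul]

end Crossed

namespace IsNontrivialHopfQuotient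

variable {k A L L' : Type*} [Field k] [Ring A] [HopfAlgebra k A] [Ring L] [HopfAlgebra k L]
  [Ring L'] [HopfAlgebra k L']

theorem of_bialgEquiv (h : IsNontrivialHopfQuotient k A L') (e : L ≃ₐc[k] L') :
    IsNontrivialHopfQuotient k A L := by
  obtain ⟨π, hπ, hinj, hrank⟩ := h
  refine ⟨(e.symm : L' →ₐc[k] L).comp π, e.symm.surjective.comp hπ,
    fun h => hinj (Function.Injective.of_comp (f := e.symm) h), ?_⟩
  rw [← Cardinal.one_lt_lift_iff, LinearEquiv.lift_rank_eq (e : L ≃ₗ[k] L'),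
    Cardinal.one_lt_lift_iff]
  exact hrank

end IsNontrivialHopfQuotient

section

variable {k Γ H : Type*} [Field k] [Group Γ] [Group H] [MulDistribMulAction H Γ]
  [DecidableEq H] [Fintype H] [Nontrivial H]

theorem SmashCoproduct.isNontrivialHopfQuotient_monoidAlgebra {G : Type*} [Group G] [Nontrivial G]
    {f : Γ →* G} (hf : Function.Surjective f) :
    IsNontrivialHopfQuotient k (SmashCoproduct k Γ H) (MonoidAlgebra k G) := by
  refine ⟨(MonoidAlgebra.mapDomainBialgHom k f).comp (toMonoidAlgebra k Γ H), ?_,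
    fun hinj => ?_, ?_⟩
  · refine Function.Surjective.comp (g := MonoidAlgebra.mapDomainBialgHom k f) (fun y => ?_)
      toMonoidAlgebra_surjective
    obtain ⟨z, hz⟩ := Finsupp.mapDomain_surjective hf y.coeff
    exact ⟨.ofCoeff z, MonoidAlgebra.coeff_injective hz⟩
  · obtain ⟨h, hh⟩ := exists_ne (1 : H)
    refine Crossed.of_ne_zero (D := CocycleDatum.trivial k Γ H) 1 h (hinj ?_)
    rw [map_zero, BialgHom.coe_comp, Function.comp_apply, toMonoidAlgebra_of, if_neg hh, map_zero]
  · rw [LinearEquiv.rank_eq (MonoidAlgebra.coeffLinearEquiv k), rank_finsupp_self,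
      Cardinal.one_lt_lift_iff, Cardinal.one_lt_iff_nontrivial]
    infer_instance

theorem QuotientDatum.isNontrivialHopfQuotient_twisted {E : QuotientDatum k Γ H} (hN : E.N ≠ ⊥) :
    IsNontrivialHopfQuotient k (SmashCoproduct k Γ H) E.Twisted := by
  refine ⟨E.proj, E.proj_surjective, fun hinj => hN ((Subgroup.eq_bot_iff_forall _).2 ?_),
    Crossed.one_lt_rank⟩
  intro r hr
  have h : E.proj (SmashCoproduct.of k r 1) = E.proj (SmashCoproduct.of k 1 1) := by
    rw [proj_of, proj_of, val_at_one, val_at_one, (QuotientGroup.eq_one_iff r).2 hr,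
      QuotientGroup.mk_one]
  exact Crossed.of_injective 1 (hinj h)

end

theorem moduleFinite_congr {R L L' : Type*} [CommSemiring R] [Semiring L] [Bialgebra R L]
    [Semiring L'] [Bialgebra R L'] (e : L ≃ₐc[R] L') : Module.Finite R L ↔ Module.Finite R L' :=
  Module.Finite.equiv_iff (e : L ≃ₗ[R] L')

namespace DInf

variable {k L : Type*} [Field k] [Ring L] [HopfAlgebra k L]

theorem N_ne_bot (m : ℕ+) : N m ≠ ⊥ := by
  rw [N, Ne, Subgroup.zpowers_eq_bot]
  exact fun h => one_ne_zero (N_injective m (a₁ := 1) (a₂ := 0) (by simp [h]))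

theorem nonempty_bialgEquiv_monoidAlgebra {u : DInf →* L} (hu : ∀ r, IsGroupLikeElem k (u r))
    (hspan : Submodule.span k (Set.range u) = ⊤) (hrank : 1 < Module.rank k L) :
    (∃ m : ℕ+, Nonempty (L ≃ₐc[k] MonoidAlgebra k (DihedralGroup m))) ∨
      Nonempty (L ≃ₐc[k] MonoidAlgebra k DInf) := by
  have hval : Submodule.span k (Set.range (GroupLike.val : GroupLike k L → L)) = ⊤ := by
    rw [eq_top_iff, ← hspan]
    refine Submodule.span_mono ?_
    rintro _ ⟨r, rfl⟩
    exact ⟨⟨u r, hu r⟩, rfl⟩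
  obtain ⟨e⟩ := nonempty_bialgEquiv_monoidAlgebra_groupLike hval
  obtain h | ⟨⟨f⟩⟩ | ⟨m, ⟨f⟩⟩ := quotient_cases (toGroupLike_surjective hu hspan)
  · have hle : Module.rank k L ≤ 1 := by
      rw [← rank_top, ← hval]
      exact (rank_span_le _).trans <|
        Cardinal.mk_range_le.trans (Cardinal.le_one_iff_subsingleton.2 h)
    exact absurd hrank hle.not_gt
  · exact .inr ⟨e.trans (MonoidAlgebra.domCongrBialgEquiv k k f.symm)⟩
  · exact .inl ⟨m, ⟨e.trans (MonoidAlgebra.domCongrBialgEquiv k k f)⟩⟩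

/-- The span contains `1 = 1 # δ_1 + 1 # δ_h` and `1 # χ = 1 # δ_1 - 1 # δ_h`, where `2` is
invertible. -/
theorem nonempty_crossed_bialgEquiv {Q : Type*} [Group Q] [Subsingleton Q]
    [MulDistribMulAction C₂ Q] (hk : ringChar k ≠ 2) (D : CocycleDatum k Q C₂) :
    (∃ m : ℕ+, Nonempty (Crossed D ≃ₐc[k] MonoidAlgebra k (DihedralGroup m))) ∨
      Nonempty (Crossed D ≃ₐc[k] MonoidAlgebra k DInf) := by
  have h2 : (2 : k) ≠ 0 := Ring.two_ne_zero hk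
  let s : C₂ →* kˣ := C₂.lift (-1) (by simp)
  have hs : s * s = 1 := MonoidHom.ext fun t => by
    obtain rfl | rfl := C₂.eq_one_or_gen t <;> simp [s]
  let u : DInf →* Crossed D :=
    (Crossed.character D).comp (Monoid.Coprod.lift (C₂.lift s hs) 1)
  have hu1 : u 1 = Crossed.of D 1 1 + Crossed.of D 1 C₂.gen := by
    rw [map_one, Crossed.one_def, C₂.sum_eq]
  have hug : u g₀ = Crossed.of D 1 1 - Crossed.of D 1 C₂.gen := by
    simp [u, g₀, s, Crossed.character_apply, C₂.sum_eq, sub_eq_add_neg]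
  refine nonempty_bialgEquiv_monoidAlgebra (u := u)
    (fun r => Crossed.isGroupLikeElem_character D _) ?_ Crossed.one_lt_rank
  have h1 : Crossed.of D 1 1 = (2 : k)⁻¹ • (u 1 + u g₀) := by
    rw [eq_inv_smul_iff₀ h2, two_smul, hu1, hug]
    abel
  have hg : Crossed.of D 1 C₂.gen = (2 : k)⁻¹ • (u 1 - u g₀) := by
    rw [eq_inv_smul_iff₀ h2, two_smul, hu1, hug]
    abel
  have mem (r : DInf) : u r ∈ Submodule.span k (Set.range u) := Submodule.subset_span ⟨r, rfl⟩
  rw [eq_top_iff, ← Crossed.span_of, Submodule.span_le, Set.range_subset_iff]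
  intro ⟨x, t⟩
  rw [SetLike.mem_coe, Subsingleton.elim x 1]
  obtain rfl | rfl := C₂.eq_one_or_gen t
  · rw [h1]
    exact Submodule.smul_mem _ _ (add_mem (mem 1) (mem g₀))
  · rw [hg]
    exact Submodule.smul_mem _ _ (sub_mem (mem 1) (mem g₀))

theorem classification_of_surjective {π : HopfDInf k →ₐc[k] L} (hk : ringChar k ≠ 2)
    (hπ : Function.Surjective π) (hinj : ¬ Function.Injective π) (hrank : 1 < Module.rank k L) :
    (∃ m : ℕ+, Nonempty (L ≃ₐc[k] MonoidAlgebra k (DihedralGroup m))) ∨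
      Nonempty (L ≃ₐc[k] MonoidAlgebra k DInf) ∨
      (∃ m : ℕ+, Nonempty (L ≃ₐc[k] HopfA k m)) ∨ (∃ m : ℕ+, Nonempty (L ≃ₐc[k] HopfB k m)) := by
  by_cases hgen : π (SmashCoproduct.of k 1 C₂.gen) = 0
  · have h0 (t : C₂) (ht : t ≠ 1) : π (SmashCoproduct.of k 1 t) = 0 :=
      (C₂.eq_one_or_gen t).resolve_left ht ▸ hgen
    exact (nonempty_bialgEquiv_monoidAlgebra (SmashCoproduct.isGroupLikeElem_groupHom h0)
      (SmashCoproduct.span_groupHom h0 hπ) hrank).imp_right .inl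
  have h0 (t : C₂) : π (SmashCoproduct.of k 1 t) ≠ 0 := by
    obtain rfl | rfl := C₂.eq_one_or_gen t
    · exact Crossed.map_of_one_ne_zero
    · exact hgen
  obtain ⟨e⟩ := SmashCoproduct.nonempty_bialgEquiv_twisted h0 hπ
  obtain hN | hN | ⟨m, hE | hE⟩ := quotientDatum_cases (SmashCoproduct.quotientDatum h0)
  · exact absurd (SmashCoproduct.injective_of_kernel_eq_bot h0 hN) hinj
  · have : Subsingleton (DInf ⧸ (SmashCoproduct.quotientDatum h0).N) := by
      rw [hN]
      exact QuotientGroup.subsingleton_quotient_top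
    exact (nonempty_crossed_bialgEquiv hk _).imp
      (fun ⟨m, ⟨f⟩⟩ => ⟨m, ⟨e.trans f⟩⟩) (fun ⟨f⟩ => .inl ⟨e.trans f⟩)
  · rw [hE] at e
    obtain ⟨f⟩ := QuotientDatum.nonempty_bialgEquiv_smashCoproduct
      (E := .ofSubgroup k (N m) (N_stable m)) rfl
    exact .inr (.inr (.inl ⟨m, ⟨e.trans f⟩⟩))
  · rw [hE] at e
    exact .inr (.inr (.inr ⟨m, ⟨e⟩⟩))

theorem isNontrivialHopfQuotient_iff (hk : ringChar k ≠ 2) :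
    IsNontrivialHopfQuotient k (HopfDInf k) L ↔
      (∃ m : ℕ+, Nonempty (L ≃ₐc[k] MonoidAlgebra k (DihedralGroup m))) ∨
      Nonempty (L ≃ₐc[k] MonoidAlgebra k DInf) ∨
      (∃ m : ℕ+, Nonempty (L ≃ₐc[k] HopfA k m)) ∨
      (∃ m : ℕ+, Nonempty (L ≃ₐc[k] HopfB k m)) := by
  refine ⟨fun ⟨π, hπ, hinj, hrank⟩ => classification_of_surjective hk hπ hinj hrank, ?_⟩
  rintro (⟨m, ⟨e⟩⟩ | ⟨⟨e⟩⟩ | ⟨m, ⟨e⟩⟩ | ⟨m, ⟨e⟩⟩)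
  · exact (SmashCoproduct.isNontrivialHopfQuotient_monoidAlgebra
      (toDihedral_surjective m)).of_bialgEquiv e
  · exact (SmashCoproduct.isNontrivialHopfQuotient_monoidAlgebra
      (f := MonoidHom.id DInf) Function.surjective_id).of_bialgEquiv e
  · obtain ⟨f⟩ := QuotientDatum.nonempty_bialgEquiv_smashCoproduct
      (E := .ofSubgroup k (N m) (N_stable m)) rfl
    exact (QuotientDatum.isNontrivialHopfQuotient_twisted (N_ne_bot m)).of_bialgEquiv
      (e.trans f.symm)
  · exact (QuotientDatum.isNontrivialHopfQuotient_twisted (N_ne_bot m)).of_bialgEquiv e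

instance (m : ℕ+) : Module.Finite k (HopfB k m) :=
  have : Finite (DInf ⧸ (datum k m).N) := inferInstanceAs (Finite (DInf ⧸ N m))
  inferInstanceAs (Module.Finite k (Crossed (datum k m).cocycleDatum))

theorem not_finite_monoidAlgebra : ¬ Module.Finite k (MonoidAlgebra k DInf) := fun h => by
  have : Module.Finite k (DInf →₀ k) := Module.Finite.equiv (MonoidAlgebra.coeffLinearEquiv k)
  have : Finite DInf := Module.Finite.finite_basis (Finsupp.basisSingleOne (R := k) (ι := DInf))
  exact not_finite DInf

end DInf

end

theorem proposition3p1 (k : Type*) [Field k] (hk : ringChar k ≠ 2) :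
    (∀ (L : Type*) [Ring L] [HopfAlgebra k L],
      IsNontrivialHopfQuotient k (HopfDInf k) L ↔
        (∃ m : ℕ+, Nonempty (L ≃ₐc[k] MonoidAlgebra k (DihedralGroup m))) ∨
        Nonempty (L ≃ₐc[k] MonoidAlgebra k DInf) ∨
        (∃ m : ℕ+, Nonempty (L ≃ₐc[k] HopfA k m)) ∨
        (∃ m : ℕ+, Nonempty (L ≃ₐc[k] HopfB k m))) ∧
    (∀ m : ℕ+, Nonempty (HopfA k m ≃ₐc[k] SmashCoproduct k (DihedralGroup m) C₂)) ∧
    (∀ (L : Type*) [Ring L] [HopfAlgebra k L],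
      (IsNontrivialHopfQuotient k (HopfDInf k) L ∧ ¬ Module.Finite k L) ↔
        Nonempty (L ≃ₐc[k] MonoidAlgebra k DInf)) := by
  refine ⟨fun L _ _ => DInf.isNontrivialHopfQuotient_iff hk, fun m =>
    SmashCoproduct.nonempty_bialgEquiv (DInf.quotientEquiv m) (DInf.quotientEquiv_smul m),
    fun L _ _ => ?_⟩
  rw [DInf.isNontrivialHopfQuotient_iff hk]
  refine ⟨fun ⟨h, hfin⟩ => ?_, fun ⟨e⟩ => ⟨.inr (.inl ⟨e⟩), fun hfin => ?_⟩⟩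
  · obtain ⟨m, ⟨e⟩⟩ | h | ⟨m, ⟨e⟩⟩ | ⟨m, ⟨e⟩⟩ := h
    · have : NeZero (m : ℕ) := ⟨m.ne_zero⟩
      exact absurd ((moduleFinite_congr e).2 inferInstance) hfin
    · exact h
    · exact absurd ((moduleFinite_congr e).2 inferInstance) hfin
    · exact absurd ((moduleFinite_congr e).2 inferInstance) hfin
  · exact DInf.not_finite_monoidAlgebra ((moduleFinite_congr e).1 hfin)
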